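/- **Setting.** Let $\Theta$ be one chiral component of the stress tensor of a unitary, positive-energy conformal field theory on two-dimensional Minkowski space with central charge $c>0$ and a conformally invariant vacuum. Concretely: on a Hilbert space $H$ there is a dense domain $D$ and a complex-linear map $F\mapsto\Theta(F)$ from smooth $2\pi$-periodic functions $F:\mathbb R\to\mathbb C$ (vector fields $F(\theta)\partial_\theta$ on the circle) to operators $D\to D$ such that * the matrix elements $\langle\varphi,\Theta(\cdot)\psi\rangle$, $\varphi,\psi\in D$, are distributions on the circle, and $\langle\varphi,\Theta(F)\psi\rangle=\langle\Theta(\overline F)\varphi,\psi\rangle$; * on $D$, $[\Theta(F),\Theta(G)]=-i\,\Theta(F'G-FG')+\frac{ic}{24\pi}\int_0^{2\pi}G\,(F'''+F')\,d\theta\cdot 1$ (for $L_n=\Theta(e^{in\theta})$ these are the Virasoro relations $[L_m,L_n]=(m-n)L_{m+n}+\frac{c}{12}m(m^2-1)\delta_{m+n,0}$); * every orientation-preserving diffeomorphism of the circle, with lift $\rho$, is implemented by a unitary $U$ with $UD=D$ and, on $D$, $U\Theta(F)U^{-1}=\Theta(\rho_*F)-\frac{c}{24\pi}\int_0^{2\pi}F\,\big(\{\rho,\theta\}+\tfrac12(\rho'^2-1)\big)d\theta\cdot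 1$, where $\rho_*F=(\rho'F)\circ\rho^{-1}$ and $\{\rho,\theta\}=-2\sqrt{\rho'}\,(1/\sqrt{\rho'})''$ is the Schwarzian derivative; * with $T(f)=\int T(v)f(v)\,dv:=\Theta(F)$, $F(\theta)=(1+\cos\theta)f(\tan(\theta/2))$ (the vector field $f(v)\partial_v$ in the coordinate $v=\tan(\theta/2)$), for all $f$ for which $F$ is smooth on the circle, the spectrum condition $\langle\psi,T(1)\psi\rangle\ge0$ holds for all $\psi\in D$; * there is a unit vector $\Omega\in D$ with $L_{-1}\Omega=L_0\Omega=L_1\Omega=0$ (the vacuum). **Statement.** Let $\tau>0$ and let $f(v)=e^{-v^2/\tau^2}/(\tau\sqrt\pi)$. 1. For all real $\mu$ with $|\mu|<\pi\tau^2$ the moment generating function converges, with $$M[\mu f]=\sum_{n\ge0}\frac{\mu^n}{n!}\langle\Omega,T(f)^n\Omega\rangle=\left[\frac{e^{-\mu/(\pi\tau^2)}}{1-\mu/(\pi\tau^2)}\right]^{c/24}.$$ 2. Let $P$ be the shifted Gamma distribution with shift $\omega_0=\frac{c}{24\pi\tau^2}$, shape $\alpha=\frac c{24}$ and rate $\beta=\pi\tau^2$,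 i.e. the measure on $\mathbb R$ with density $\beta^\alpha(\omega+\omega_0)^{\alpha-1}e^{-\beta(\omega+\omega_0)}/\Gamma(\alpha)$ for $\omega>-\omega_0$ and $0$ for $\omega<-\omega_0$. Then $P$ is a probability measure; $\int e^{\mu\omega}\,dP(\omega)$ converges and equals the right-hand side of (1) for all real $\mu<\pi\tau^2$; and $\int\omega^n\,dP=\langle\Omega,T(f)^n\Omega\rangle$ for all $n\ge0$, all these integrals converging absolutely. 3. $P$ is the only measure on $\mathbb R$ with these moments. 4. Individual measurements of $T(f)$ in the vacuum are distributed according to $P$: for every self-adjoint extension $A$ of $T(f)$ (with domain $D$), $P$ is the spectral measure of $A$ at $\Omega$, that is, $\langle\Omega,(A-z)^{-1}\Omega\rangle=\int(\omega-z)^{-1}dP(\omega)$ for all $z\in\mathbb C\setminus\mathbb R$. 5. The smallest element of the support of $P$ is the sharp quantum energy inequality bound: it equals $$-\frac{c}{12\pi}\int_{\mathbb R}\Big(\frac{d}{dv}\sqrt{f(v)}\Big)^2dv=-\frac{c}{24\pi\tau^2},$$ and this number is the greatest lower bound of the expectation values $\langle\psi,T(f)\psi\rangle$ over unit vectors $\psi\in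 D$. -/

import Mathlib

open MeasureTheory ProbabilityTheory
open scoped ComplexConjugate

noncomputable section

namespace CFT

section Fields

open scoped ContDiff

/-- Complex test functions on the circle, written as smooth `2π`-periodic functions of the
angle. An element `F` is thought of as the vector field `F(θ) ∂_θ`. -/
def circleFn : Submodule ℂ (ℝ → ℂ) where
  carrier := {F | ContDiff ℝ ∞ F ∧ Function.Periodic F (2 * Real.pi)}
  add_mem' := fun h k => ⟨h.1.add k.1, h.2.add k.2⟩
  zero_mem' := ⟨contDiff_const, fun _ => rfl⟩
  smul_mem' := fun a F h => ⟨contDiff_const.smul h.1, fun θ => by simp [h.2 θ]⟩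

theorem deriv_mem {F : ℝ → ℂ} (h : F ∈ circleFn) : deriv F ∈ circleFn := by
  refine ⟨(contDiff_infty_iff_deriv.1 h.1).2, fun θ => ?_⟩
  rw [← deriv_comp_add_const]
  congr 1
  exact funext h.2

theorem mul_mem {F G : ℝ → ℂ} (h : F ∈ circleFn) (k : G ∈ circleFn) :
    F * G ∈ circleFn :=
  ⟨h.1.mul k.1, h.2.mul k.2⟩

/-- Pointwise complex conjugation of circle test functions. -/
def conjFn (F : circleFn) : circleFn :=
  ⟨fun θ => conj (F.1 θ), Complex.conjCLE.contDiff.comp F.2.1, fun θ => by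
    simp only [F.2.2 θ]⟩

/-- The bracket `F' G - F G'` of two circle test functions. -/
def bracket (F G : circleFn) : circleFn :=
  ⟨deriv F.1 * G.1 - F.1 * deriv G.1,
    circleFn.sub_mem (mul_mem (deriv_mem F.2) G.2) (mul_mem F.2 (deriv_mem G.2))⟩

/-- The Fourier mode `θ ↦ exp(i n θ)`. -/
def mode (n : ℤ) : circleFn :=
  ⟨fun θ => Complex.exp (Complex.I * n * θ),
    (contDiff_const.mul Complex.ofRealCLM.contDiff).cexp, fun θ => by
    rw [Complex.exp_eq_exp_iff_exists_int]
    exact ⟨n, by push_cast; ring⟩⟩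

/-- The null line is the circle without one point through the Cayley map
`v ↦ (i - v) / (i + v) = exp(i θ)`, that is, `v = tan (θ / 2)`. The vector field `f(v) ∂_v` has
the component `f(v) dθ/dv = (1 + cos θ) f(tan (θ / 2))` along `∂_θ`; at the point at infinity,
`θ = π`, the expression is `0`. -/
def toCircle (f : ℝ → ℂ) : ℝ → ℂ :=
  fun θ => ((1 + Real.cos θ : ℝ) : ℂ) * f (Real.tan (θ / 2))

theorem toCircle_one_mem : toCircle (fun _ => 1) ∈ circleFn := by
  refine ⟨?_, fun θ => by simp only [toCircle, Real.cos_add_two_pi]⟩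
  have h : toCircle (fun _ => 1) = fun θ => ((1 + Real.cos θ : ℝ) : ℂ) := by
    ext θ; rw [toCircle, mul_one]
  rw [h]
  exact Complex.ofRealCLM.contDiff.comp (contDiff_const.add Real.contDiff_cos)

/-- The Schwarzian derivative `{V, v} = -2 √V' (1 / √V')''`. -/
def schwarzian (V : ℝ → ℝ) (v : ℝ) : ℝ :=
  -2 * √(deriv V v) * iteratedDeriv 2 (fun w => 1 / √(deriv V w)) v

/-- Orientation preserving diffeomorphisms of the circle, lifted to the angle variable (the
universal cover of `Diff₊(S¹)`). -/
def IsCircleDiffeo (ρ : ℝ → ℝ) : Prop :=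
  ContDiff ℝ ∞ ρ ∧ (∀ θ, 0 < deriv ρ θ) ∧ ∀ θ, ρ (θ + 2 * Real.pi) = ρ θ + 2 * Real.pi

/-- The anomalous term of `ρ` in the angle variable, namely `(dz/dθ)² {Z, z}` for `z = exp(i θ)`
and `Z = exp(i ρ(θ))`. The Cayley map being a Möbius map, this is also `(dv/dθ)² {V, v}` for the
reparametrization `V` of the null line that corresponds to `ρ`. -/
def anomaly (ρ : ℝ → ℝ) (θ : ℝ) : ℝ :=
  schwarzian ρ θ + ((deriv ρ θ) ^ 2 - 1) / 2

/-- One chiral component of the stress tensor of a unitary, positive energy conformal field theory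
with central charge `c` on two-dimensional Minkowski space, with its conformally invariant
vacuum. `Θ(F)` is the stress tensor of the conformally compactified null line, smeared with the
vector field `F(θ) ∂_θ`. -/
structure ChiralCFT (H : Type*) [NormedAddCommGroup H] [InnerProductSpace ℂ H]
    (c : ℝ) where
  /-- The common invariant domain of the smeared fields. -/
  D : Submodule ℂ H
  dense_D : Dense (D : Set H)
  /-- The smeared stress tensor. -/
  Θ : circleFn →ₗ[ℂ] Module.End ℂ D
  /-- Matrix elements of the stress tensor are distributions on the circle. -/
  distribution : ∀ φ ψ : D, ∃ (N : ℕ) (C : ℝ), ∀ (F : circleFn) (B : ℝ),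
    (∀ k ≤ N, ∀ θ : ℝ, ‖iteratedDeriv k F.1 θ‖ ≤ B) →
      ‖inner ℂ (φ : H) (Θ F ψ : H)‖ ≤ C * B
  /-- Hermiticity: `Θ(F)* = Θ(conj F)` on the domain. -/
  hermitian : ∀ (F : circleFn) (φ ψ : D),
    inner ℂ (φ : H) (Θ F ψ : H) = inner ℂ (Θ (conjFn F) φ : H) (ψ : H)
  /-- The commutation relations with central charge `c`. With `L_n = Θ(exp(i n θ))` they read
  `[L_m, L_n] = (m - n) L_{m+n} + (c / 12) m (m² - 1) δ_{m+n,0}`. -/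
  commutator : ∀ (F G : circleFn) (ψ : D),
    Θ F (Θ G ψ) - Θ G (Θ F ψ) = -Complex.I • Θ (bracket F G) ψ
      + (Complex.I * (c / (24 * Real.pi) : ℝ) * ∫ θ in (0 : ℝ)..(2 * Real.pi),
          G.1 θ * (iteratedDeriv 3 F.1 θ + deriv F.1 θ)) • ψ
  /-- Reparametrizations are unitarily implemented: there is a unitary `U` with
  `U Θ(θ) U⁻¹ = ρ'(θ)² Θ(ρ(θ)) - (c / 24 π) anomaly(θ)`. Here this is smeared with `F`, and `G` is
  the push-forward of the vector field `F` along `ρ`. -/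
  covariant : ∀ ρ : ℝ → ℝ, IsCircleDiffeo ρ → ∃ U : H ≃ₗᵢ[ℂ] H,
    (∀ x, U x ∈ D ↔ x ∈ D) ∧
    ∀ F G : circleFn, (∀ θ, G.1 (ρ θ) = ((deriv ρ θ : ℝ) : ℂ) * F.1 θ) →
      ∀ ψ φ : D, U ψ = φ →
        U (Θ F ψ : H) = (Θ G φ : H) - (((c / (24 * Real.pi) : ℝ) : ℂ) *
          ∫ θ in (0 : ℝ)..(2 * Real.pi), F.1 θ * (anomaly ρ θ : ℂ)) • (φ : H)
  /-- The spectrum condition `P = ∫ T(v) dv ≥ 0`. -/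
  spectrum_condition : ∀ ψ : D,
    0 ≤ (inner ℂ (ψ : H) (Θ ⟨_, toCircle_one_mem⟩ ψ : H)).re
  /-- The vacuum vector. -/
  Ω : D
  norm_Ω : ‖(Ω : H)‖ = 1
  /-- Conformal invariance of the vacuum: `L_{-1} Ω = L_0 Ω = L_1 Ω = 0`. -/
  vacuum : ∀ n : ℤ, |n| ≤ 1 → Θ (mode n) Ω = 0

/-- The Gaussian of width `τ` with unit integral. -/
def gaussian (τ v : ℝ) : ℝ := Real.exp (-v ^ 2 / τ ^ 2) / (τ * √Real.pi)

theorem one_add_cos_eq (θ : ℝ) : 1 + Real.cos θ = 2 * Real.cos (θ / 2) ^ 2 := by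
  rw [Real.cos_sq]; ring_nf

theorem toCircle_gaussian_eq {τ : ℝ} (hτ : 0 < τ) (θ : ℝ) :
    toCircle (fun v => (gaussian τ v : ℂ)) θ
      = (((1 + Real.cos θ) * (Real.exp (1 / τ ^ 2)
        * expNegInvGlue (τ ^ 2 * Real.cos (θ / 2) ^ 2) / (τ * √Real.pi)) : ℝ) : ℂ) := by
  rw [toCircle, ← Complex.ofReal_mul]
  congr 1
  by_cases h : Real.cos (θ / 2) = 0
  · simp [one_add_cos_eq, h]
  · have hp : 0 < τ ^ 2 * Real.cos (θ / 2) ^ 2 := by positivity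
    rw [gaussian, expNegInvGlue, if_neg (not_le.2 hp), ← Real.exp_add]
    congr 4
    rw [Real.tan_eq_sin_div_cos, div_pow, Real.sin_sq]
    field_simp
    ring

/-- The Gaussian is an admissible test function: it extends smoothly to the circle. -/
theorem gaussian_mem {τ : ℝ} (hτ : 0 < τ) :
    toCircle (fun v => (gaussian τ v : ℂ)) ∈ circleFn := by
  refine ⟨?_, fun θ => ?_⟩
  · rw [funext (toCircle_gaussian_eq hτ)]
    refine Complex.ofRealCLM.contDiff.comp ?_
    have h : ContDiff ℝ ∞ (fun θ : ℝ => expNegInvGlue (τ ^ 2 * Real.cos (θ / 2) ^ 2)) :=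
      expNegInvGlue.contDiff.comp (by fun_prop)
    exact ((contDiff_const.add Real.contDiff_cos).mul (contDiff_const.mul h |>.div_const _))
  · have h : (θ + 2 * Real.pi) / 2 = θ / 2 + Real.pi := by ring
    simp only [toCircle, Real.cos_add_two_pi, h, Real.tan_add_pi]

/-- Test functions on the null line: the `f` such that `f(v) ∂_v` extends to a smooth vector field
on the circle. -/
def LineFn : Type := {f : ℝ → ℂ // toCircle f ∈ circleFn}

/-- The Gaussian of width `τ` as a test function. -/
def gaussianFn {τ : ℝ} (hτ : 0 < τ) : LineFn :=
  ⟨fun v => (gaussian τ v : ℂ), gaussian_mem hτ⟩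

end Fields

namespace ChiralCFT

variable {H : Type*} [NormedAddCommGroup H] [InnerProductSpace ℂ H] {c : ℝ}

/-- The smeared field `T(f) = ∫ T(v) f(v) dv` on the null line. -/
def T (𝒞 : ChiralCFT H c) (f : LineFn) : Module.End ℂ 𝒞.D :=
  𝒞.Θ ⟨toCircle f.1, f.2⟩

/-- The vacuum moments `⟨Ω, T(f)ⁿ Ω⟩`. -/
def moment (𝒞 : ChiralCFT H c) (f : LineFn) (n : ℕ) : ℂ :=
  inner ℂ (𝒞.Ω : H) (((𝒞.T f) ^ n) 𝒞.Ω : H)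

/-- `T(f)` as an unbounded operator in `H` with domain `D`. -/
def unboundedT (𝒞 : ChiralCFT H c) (f : LineFn) :
    H →ₗ.[ℂ] H :=
  ⟨𝒞.D, 𝒞.D.subtype ∘ₗ 𝒞.T f⟩

/-- The expectation values of `T(f)` in the unit vectors of the domain. -/
def expectations (𝒞 : ChiralCFT H c) (f : LineFn) : Set ℝ :=
  {x | ∃ ψ : 𝒞.D, ‖(ψ : H)‖ = 1 ∧ (x : ℂ) = inner ℂ (ψ : H) (𝒞.T f ψ : H)}

end ChiralCFT

/-- `ν` has moments of all orders, and they are the numbers `G n`. -/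
def HasMoments (ν : Measure ℝ) (G : ℕ → ℂ) : Prop :=
  ∀ n : ℕ, Integrable (fun ω : ℝ => ω ^ n) ν ∧ ((∫ ω, ω ^ n ∂ν : ℝ) : ℂ) = G n

/-- `ν` is the law of the outcomes when the self-adjoint operator `A` is measured in the state
`x`, that is, the spectral measure of `A` at `x`: the measure whose Stieltjes transform is
`⟨x, (A - z)⁻¹ x⟩` at every non-real `z`. -/
def IsMeasurementLaw {H : Type*} [NormedAddCommGroup H] [InnerProductSpace ℂ H]
    (A : H →ₗ.[ℂ] H) (x : H) (ν : Measure ℝ) : Prop :=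
  IsFiniteMeasure ν ∧ ∀ z : ℂ, z.im ≠ 0 → ∃ y : A.domain, A y - z • (y : H) = x ∧
    inner ℂ x (y : H) = ∫ ω : ℝ, ((ω : ℂ) - z)⁻¹ ∂ν

/-- The quantum energy inequality bound `-(c / 12 π) ∫ ((d/dv) √f(v))² dv` for a nonnegative
smearing function `f`. -/
def qeiBound (c : ℝ) (f : ℝ → ℝ) : ℝ :=
  -(c / (12 * Real.pi)) * ∫ v, (deriv (fun u => √(f u)) v) ^ 2

/-- The shifted Gamma distribution with shift `ω₀`, shape `α` and rate `β`: its density is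
`β^α (ω + ω₀)^(α - 1) exp(-β (ω + ω₀)) / Γ(α)` for `ω ≥ -ω₀`, and `0` for `ω < -ω₀`. -/
def shiftedGamma (ω₀ α β : ℝ) : Measure ℝ :=
  volume.withDensity fun ω => gammaPDF α β (ω + ω₀)

end CFT

end

/-! Put `σ = 2/τ²`, `α = c/24`, `β = πτ²`. The vacuum moments satisfy a short recursion because the
Gaussian field commutes with its own positive frequency part up to a multiple of itself and a
scalar. On the line the Gaussian solves `f' + σ v f = 0`. Projection to positive frequencies
commutes with `d/dv`, and with multiplication by `v` up to a constant proportional to `∫ f = 1`.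
Hence `f₊' + σ v f₊ = i/β` (`posField_ode`), so `f₊' f - f₊ f' = (i/β) f` (`bracket_posField`). With
the central term from `central_integral` this gives `[Θ(f₊), T(f)] = T(f)/β + α/β²`.

Positive energy and the vacuum conditions give `Θ(f₊) Ω = 0`, and `Θ(f - f₊)` maps the domain into
the orthogonal complement of `Ω` (`theta_vacuum_eq_zero`). Commuting `Θ(f₊)` to the right yields
`M_{n+2} = (n+1)(M_{n+1}/β + α M_n/β²)` with `M_0 = 1`, `M_1 = 0` (`moment_add_two`). The shifted
Gamma law obeys the same recursion by Stein's identity (`stein_shiftedGamma`).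

The law has exponential moments. Its complex moment generating function is therefore analytic on a
strip, and the moments determine it (`of_moments`, `eq_of_moments`). They also make polynomials
dense in `L²(P)` in the graph norm of multiplication by `ω` (`exists_poly_tendsto`). Since `p ↦
p(T(f)) Ω` preserves the `L²(P)` inner product, approximating `1/(ω - z)` in that norm solves `(A -
z) y = Ω` for every self-adjoint extension `A`.

For the energy bound, the Gaussian vector field plus `δ²` is strictly positive, so a circle
diffeomorphism turns it into a positive multiple of `L₀ ≥ 0`; the anomaly gives the bound as `δ → 0`
(`energy_inequality`). It is sharp: for a larger lower bound `b`, approximating the indicator of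
`[a, b)` by polynomials would force `P` to vanish there, while `P` charges every right neighbourhood
of `-ω₀`. -/

open MeasureTheory ProbabilityTheory
open scoped ComplexConjugate

noncomputable section

namespace CFT

/-! ### Fourier series of smooth functions on the circle -/

section FourierSeries

open scoped ContDiff

/-- A two-sided sequence that decays faster than every power. -/
def RapidDecay (a : ℤ → ℂ) : Prop :=
  ∀ k : ℕ, Summable fun n : ℤ => |(n : ℝ)| ^ k * ‖a n‖

/-- The sum of the Fourier series with given coefficients. -/
def modeSum (a : ℤ → ℂ) (θ : ℝ) : ℂ := ∑' n : ℤ, a n * Complex.exp (Complex.I * n * θ)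

theorem norm_exp_mode (n : ℤ) (θ : ℝ) : ‖Complex.exp (Complex.I * n * θ)‖ = 1 := by
  rw [show Complex.I * n * θ = ((n * θ : ℝ) : ℂ) * Complex.I by push_cast; ring]
  exact Complex.norm_exp_ofReal_mul_I _

namespace RapidDecay

variable {a b : ℤ → ℂ}

theorem mono (ha : RapidDecay a) (C : ℝ) (h : ∀ n, ‖b n‖ ≤ C * ‖a n‖) : RapidDecay b := fun k => by
  refine Summable.of_nonneg_of_le (fun n => by positivity) (fun n => ?_) ((ha k).mul_left C)
  calc |(n : ℝ)| ^ k * ‖b n‖ ≤ |(n : ℝ)| ^ k * (C * ‖a n‖) := by gcongr; exact h n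
    _ = _ := by ring

theorem add (ha : RapidDecay a) (hb : RapidDecay b) : RapidDecay fun n => a n + b n := fun k => by
  refine Summable.of_nonneg_of_le (fun n => by positivity) (fun n => ?_) ((ha k).add (hb k))
  rw [← mul_add]
  gcongr
  exact norm_add_le _ _

theorem const_mul (ha : RapidDecay a) (z : ℂ) : RapidDecay fun n => z * a n :=
  ha.mono ‖z‖ fun _ => (norm_mul _ _).le

theorem finset_sum {ι : Type*} (s : Finset ι) {f : ι → ℤ → ℂ} (h : ∀ i ∈ s, RapidDecay (f i)) :
    RapidDecay fun n => ∑ i ∈ s, f i n := by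
  classical
  induction s using Finset.induction_on with
  | empty => intro k; simp
  | insert i s hi ih =>
    simp only [Finset.sum_insert hi]
    exact (h i (Finset.mem_insert_self _ _)).add
      (ih fun j hj => h j (Finset.mem_insert_of_mem hj))

theorem freq_mul (ha : RapidDecay a) : RapidDecay fun n => Complex.I * n * a n := fun k => by
  refine (ha (k + 1)).congr fun n => ?_
  rw [norm_mul, norm_mul, Complex.norm_I, one_mul, Complex.norm_intCast, pow_succ]
  ring

theorem freq_pow_mul (ha : RapidDecay a) (k : ℕ) :
    RapidDecay fun n => (Complex.I * n) ^ k * a n := by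
  induction k with
  | zero => simpa using ha
  | succ k ih =>
    convert! ih.freq_mul using 2
    ring

theorem shift (ha : RapidDecay a) (s : ℤ) : RapidDecay fun n => a (n - s) := fun k => by
  rw [← (Equiv.addRight s).summable_iff]
  refine Summable.of_nonneg_of_le (fun n => by simp only [Function.comp]; positivity) (fun n => ?_)
    (((ha k).add ((ha 0).mul_left (|(s : ℝ)| ^ k))).mul_left (2 ^ (k - 1)))
  simp only [Function.comp, Equiv.coe_addRight, add_sub_cancel_right, Int.cast_add, pow_zero,
    one_mul]
  have h1 : |(n : ℝ) + s| ^ k ≤ (|(n : ℝ)| + |(s : ℝ)|) ^ k :=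
    pow_le_pow_left₀ (abs_nonneg _) (abs_add_le _ _) k
  have h2 := add_pow_le (abs_nonneg (n : ℝ)) (abs_nonneg (s : ℝ)) k
  calc |(n : ℝ) + s| ^ k * ‖a n‖
      ≤ (2 ^ (k - 1) * (|(n : ℝ)| ^ k + |(s : ℝ)| ^ k)) * ‖a n‖ := by
        gcongr; exact h1.trans h2
    _ = _ := by ring

theorem summable_norm (ha : RapidDecay a) : Summable fun n => ‖a n‖ := by
  simpa using ha 0

theorem summable (ha : RapidDecay a) (θ : ℝ) :
    Summable fun n : ℤ => a n * Complex.exp (Complex.I * n * θ) := by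
  refine Summable.of_norm ?_
  simpa [norm_mul, norm_exp_mode] using ha.summable_norm

theorem hasSum (ha : RapidDecay a) (θ : ℝ) :
    HasSum (fun n : ℤ => a n * Complex.exp (Complex.I * n * θ)) (modeSum a θ) :=
  (ha.summable θ).hasSum

theorem norm_modeSum_le (ha : RapidDecay a) (θ : ℝ) : ‖modeSum a θ‖ ≤ ∑' n, ‖a n‖ := by
  have h := ha.summable_norm
  refine (norm_tsum_le_tsum_norm ?_).trans ?_ <;> simp [norm_exp_mode, h]

theorem hasDerivAt (ha : RapidDecay a) (θ : ℝ) :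
    HasDerivAt (modeSum a) (modeSum (fun n => Complex.I * n * a n) θ) θ := by
  refine hasDerivAt_tsum (u := fun n => ‖Complex.I * n * a n‖) ha.freq_mul.summable_norm
    (g := fun (n : ℤ) (θ : ℝ) => a n * Complex.exp (Complex.I * n * θ))
    (g' := fun (n : ℤ) (θ : ℝ) => Complex.I * n * a n * Complex.exp (Complex.I * n * θ))
    (fun n y => ?_) (fun n y => ?_) (ha.summable 0) θ
  · have h : HasDerivAt (fun y : ℝ => Complex.I * n * (y : ℂ)) (Complex.I * n * 1) y :=
      (Complex.ofRealCLM.hasDerivAt (x := y)).const_mul _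
    convert! (h.cexp.const_mul (a n)) using 1
    ring
  · rw [norm_mul, norm_exp_mode, mul_one]

theorem deriv_modeSum (ha : RapidDecay a) :
    deriv (modeSum a) = modeSum fun n => Complex.I * n * a n :=
  funext fun θ => (ha.hasDerivAt θ).deriv

theorem iteratedDeriv_modeSum (ha : RapidDecay a) (k : ℕ) :
    iteratedDeriv k (modeSum a) = modeSum fun n => (Complex.I * n) ^ k * a n := by
  induction k with
  | zero => simp
  | succ k ih =>
    rw [iteratedDeriv_succ, ih, (ha.freq_pow_mul k).deriv_modeSum]
    congr 1
    ext n
    ring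

theorem modeSum_mem (ha : RapidDecay a) : modeSum a ∈ circleFn := by
  refine ⟨contDiff_of_differentiable_iteratedDeriv fun k _ => ?_, fun θ => ?_⟩
  · rw [ha.iteratedDeriv_modeSum]
    exact fun θ => ((ha.freq_pow_mul k).hasDerivAt θ).differentiableAt
  · exact tsum_congr fun n => by rw [show Complex.exp _ = _ from (mode n).2.2 θ]; rfl

theorem modeSum_add (ha : RapidDecay a) (hb : RapidDecay b) (θ : ℝ) :
    modeSum (fun n => a n + b n) θ = modeSum a θ + modeSum b θ := by
  refine HasSum.tsum_eq ?_
  simpa [add_mul] using (ha.hasSum θ).add (hb.hasSum θ)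

theorem modeSum_sub (ha : RapidDecay a) (hb : RapidDecay b) (θ : ℝ) :
    modeSum (fun n => a n - b n) θ = modeSum a θ - modeSum b θ := by
  refine HasSum.tsum_eq ?_
  simpa [sub_mul] using (ha.hasSum θ).sub (hb.hasSum θ)

theorem shift_modeSum (ha : RapidDecay a) (s : ℤ) (θ : ℝ) :
    modeSum (fun n => a (n - s)) θ = Complex.exp (Complex.I * s * θ) * modeSum a θ := by
  refine HasSum.tsum_eq ?_
  rw [← (Equiv.addRight s).hasSum_iff]
  convert! (ha.hasSum θ).mul_left (Complex.exp (Complex.I * s * θ)) using 2 with n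
  simp only [Function.comp, Equiv.coe_addRight, add_sub_cancel_right, Int.cast_add]
  rw [show Complex.I * ((n : ℂ) + s) * θ = Complex.I * s * θ + Complex.I * n * θ by ring,
    Complex.exp_add]
  ring

/-- The coefficients of `∑ s, exp(i s θ) (p s g' + r s g)` for the function `g` with
coefficients `a`. -/
def _root_.CFT.band (p r : ℤ → ℂ) (a : ℤ → ℂ) (n : ℤ) : ℂ :=
  ∑ s ∈ Finset.Icc (-2 : ℤ) 2, (p s * (Complex.I * (n - s : ℤ)) + r s) * a (n - s)

theorem band_aux (ha : RapidDecay a) (p r : ℂ) :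
    RapidDecay fun n => (p * (Complex.I * n) + r) * a n := by
  have h := (ha.freq_mul.const_mul p).add (ha.const_mul r)
  convert! h using 2
  ring

theorem band (ha : RapidDecay a) (p r : ℤ → ℂ) : RapidDecay (CFT.band p r a) :=
  finset_sum _ fun s _ => (ha.band_aux (p s) (r s)).shift s

theorem modeSum_finset_sum {ι : Type*} (s : Finset ι) {f : ι → ℤ → ℂ}
    (h : ∀ i ∈ s, RapidDecay (f i)) (θ : ℝ) :
    modeSum (fun n => ∑ i ∈ s, f i n) θ = ∑ i ∈ s, modeSum (f i) θ := by
  refine HasSum.tsum_eq ?_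
  simpa [Finset.sum_mul] using hasSum_sum fun i hi => (h i hi).hasSum θ

/-- A factor `exp(i s θ)` shifts coefficients and `d/dθ` multiplies them by `i n`, so a first-order
operator whose coefficients are trigonometric polynomials of degree two acts as a five-term
recurrence. This turns the differential equation of the Gaussian into a statement about
coefficients, where frequencies can be cut. -/
theorem modeSum_band (ha : RapidDecay a) (p r : ℤ → ℂ) (θ : ℝ) :
    modeSum (CFT.band p r a) θ = ∑ s ∈ Finset.Icc (-2 : ℤ) 2,
      Complex.exp (Complex.I * s * θ) * (p s * deriv (modeSum a) θ + r s * modeSum a θ) := by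
  rw [show CFT.band p r a = fun n => ∑ s ∈ Finset.Icc (-2 : ℤ) 2,
    (fun m : ℤ => (p s * (Complex.I * m) + r s) * a m) (n - s) from rfl,
    modeSum_finset_sum _ fun s _ => (ha.band_aux (p s) (r s)).shift s]
  refine Finset.sum_congr rfl fun s _ => ?_
  rw [(ha.band_aux (p s) (r s)).shift_modeSum, ha.deriv_modeSum]
  congr 1
  refine HasSum.tsum_eq ?_
  convert! ((ha.freq_mul.hasSum θ).mul_left (p s)).add ((ha.hasSum θ).mul_left (r s)) using 2 with n
  ring

theorem integral_modeSum (ha : RapidDecay a) :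
    ∫ θ in (0 : ℝ)..(2 * Real.pi), modeSum a θ = 2 * Real.pi * a 0 := by
  have h := intervalIntegral.hasSum_intervalIntegral_of_summable_norm (a := 0) (b := 2 * Real.pi)
    (f := fun n : ℤ => ⟨fun θ : ℝ => a n * Complex.exp (Complex.I * n * θ),
      continuous_const.mul (mode n).2.1.continuous⟩) (by
      refine Summable.of_nonneg_of_le (fun n => norm_nonneg _) (fun n => ?_) ha.summable_norm
      rw [ContinuousMap.norm_le _ (norm_nonneg _)]
      intro x
      simp [norm_exp_mode])
  refine h.unique ?_
  convert! hasSum_ite_eq (0 : ℤ) (2 * Real.pi * a 0) using 2 with n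
  simp only [ContinuousMap.coe_mk, intervalIntegral.integral_const_mul]
  split_ifs with hn
  · subst hn
    simp
    ring
  · rw [integral_exp_mul_complex (c := Complex.I * n) (by simp [hn]),
      Complex.exp_eq_one_iff.2 ⟨n, by push_cast; ring⟩]
    simp

theorem coeff_eq (ha : RapidDecay a) (n : ℤ) :
    ∫ θ in (0 : ℝ)..(2 * Real.pi), Complex.exp (Complex.I * (-n : ℤ) * θ) * modeSum a θ
      = 2 * Real.pi * a n := by
  simp_rw [← ha.shift_modeSum]
  rw [(ha.shift _).integral_modeSum]
  simp

end RapidDecay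

/-- The Fourier coefficients of a function on the circle. -/
def fourierSeq (g : ℝ → ℂ) (n : ℤ) : ℂ :=
  (1 / (2 * Real.pi) : ℂ) *
    ∫ θ in (0 : ℝ)..(2 * Real.pi), Complex.exp (Complex.I * (-n : ℤ) * θ) * g θ

theorem RapidDecay.fourierSeq_modeSum {a : ℤ → ℂ} (ha : RapidDecay a) :
    fourierSeq (modeSum a) = a := by
  ext n
  rw [fourierSeq, ha.coeff_eq]
  field_simp

theorem RapidDecay.ext {a b : ℤ → ℂ} (ha : RapidDecay a) (hb : RapidDecay b)
    (h : ∀ θ, modeSum a θ = modeSum b θ) : a = b := by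
  rw [← ha.fourierSeq_modeSum, ← hb.fourierSeq_modeSum, funext h]

theorem integral_deriv_eq_zero {g : ℝ → ℂ} (hg : g ∈ circleFn) :
    ∫ θ in (0 : ℝ)..(2 * Real.pi), deriv g θ = 0 := by
  rw [intervalIntegral.integral_deriv_eq_sub
    (fun x _ => (hg.1.differentiable (by simp)).differentiableAt)
    ((deriv_mem hg).1.continuous.intervalIntegrable _ _)]
  simpa [sub_eq_zero] using hg.2 0

theorem fourierSeq_deriv {g : ℝ → ℂ} (hg : g ∈ circleFn) (n : ℤ) :
    fourierSeq (deriv g) n = Complex.I * n * fourierSeq g n := by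
  have h := integral_deriv_eq_zero (mul_mem (mode (-n)).2 hg)
  have hd : ∀ θ : ℝ, deriv ((mode (-n)).1 * g) θ =
      Complex.exp (Complex.I * (-n : ℤ) * θ) * deriv g θ
        - Complex.I * n * (Complex.exp (Complex.I * (-n : ℤ) * θ) * g θ) := by
    intro θ
    have h1 : HasDerivAt (fun y : ℝ => Complex.I * (-n : ℤ) * (y : ℂ))
        (Complex.I * (-n : ℤ) * 1) θ := (Complex.ofRealCLM.hasDerivAt (x := θ)).const_mul _
    have h2 := h1.cexp.mul ((hg.1.differentiable (by simp)) θ).hasDerivAt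
    refine HasDerivAt.deriv (h2.congr_deriv ?_)
    push_cast
    ring
  simp_rw [hd] at h
  have hi : ∀ u : ℝ → ℂ, u ∈ circleFn → IntervalIntegrable
      (fun θ : ℝ => Complex.exp (Complex.I * (-n : ℤ) * θ) * u θ) volume 0 (2 * Real.pi) :=
    fun u hu => (mul_mem (mode (-n)).2 hu).1.continuous.intervalIntegrable _ _
  rw [intervalIntegral.integral_sub (hi _ (deriv_mem hg)) ((hi _ hg).const_mul _),
    intervalIntegral.integral_const_mul, sub_eq_zero] at h
  rw [fourierSeq, fourierSeq, h]
  ring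

theorem iteratedDeriv_mem {g : ℝ → ℂ} (hg : g ∈ circleFn) (k : ℕ) :
    iteratedDeriv k g ∈ circleFn := by
  induction k with
  | zero => simpa using hg
  | succ k ih => rw [iteratedDeriv_succ]; exact deriv_mem ih

theorem fourierSeq_iteratedDeriv {g : ℝ → ℂ} (hg : g ∈ circleFn) (k : ℕ) (n : ℤ) :
    fourierSeq (iteratedDeriv k g) n = (Complex.I * n) ^ k * fourierSeq g n := by
  induction k with
  | zero => simp
  | succ k ih =>
    rw [iteratedDeriv_succ, fourierSeq_deriv (iteratedDeriv_mem hg k), ih]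
    ring

theorem fourierSeq_bounded {g : ℝ → ℂ} (hg : g ∈ circleFn) :
    ∃ C : ℝ, ∀ n, ‖fourierSeq g n‖ ≤ C := by
  obtain ⟨B, hB⟩ := (isCompact_uIcc (a := (0 : ℝ)) (b := 2 * Real.pi)).exists_bound_of_continuousOn
    hg.1.continuous.continuousOn
  refine ⟨‖(1 / (2 * Real.pi) : ℂ)‖ * (B * |2 * Real.pi - 0|), fun n => ?_⟩
  rw [fourierSeq, norm_mul]
  gcongr
  refine intervalIntegral.norm_integral_le_of_norm_le_const fun x hx => ?_
  rw [norm_mul, norm_exp_mode, one_mul]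
  exact hB x (Set.uIoc_subset_uIcc hx)

/-- The coefficients of the derivative of order `k + 2` are bounded, which leaves `1/n²` to sum
after the weight `|n|^k`. -/
theorem rapidDecay_fourierSeq {g : ℝ → ℂ} (hg : g ∈ circleFn) : RapidDecay (fourierSeq g) := by
  intro k
  obtain ⟨C, hC⟩ := fourierSeq_bounded (iteratedDeriv_mem hg (k + 2))
  have hs : Summable fun n : ℤ => C * (1 / |(n : ℝ)| ^ 2) := by
    refine Summable.mul_left C ?_
    simpa using (Real.summable_one_div_int_pow (p := 2)).2 (by norm_num)
  refine Summable.of_norm_bounded_eventually hs ?_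
  -- At `n = 0` the majorant is `C * (1 / 0) = 0`, so that point is left out of the comparison.
  filter_upwards [(Set.finite_singleton (0 : ℤ)).compl_mem_cofinite] with n hn
  have hn' : (0 : ℝ) < |(n : ℝ)| := abs_pos.2 (by exact_mod_cast hn)
  have h := hC n
  rw [fourierSeq_iteratedDeriv hg, norm_mul, norm_pow, norm_mul, Complex.norm_I, one_mul,
    Complex.norm_intCast] at h
  rw [Real.norm_of_nonneg (by positivity), mul_one_div, le_div_iff₀ (by positivity)]
  calc _ = |(n : ℝ)| ^ (k + 2) * ‖fourierSeq g n‖ := by ring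
    _ ≤ C := h

/-- A smooth function on the circle is the sum of its Fourier series. -/
theorem modeSum_fourierSeq {g : ℝ → ℂ} (hg : g ∈ circleFn) : modeSum (fourierSeq g) = g := by
  have : Fact (0 < 2 * Real.pi) := ⟨Real.two_pi_pos⟩
  have hcont : Continuous (hg.2.lift : AddCircle (2 * Real.pi) → ℂ) := by
    exact hg.1.continuous.quotient_liftOn' _
  have he : ∀ (n : ℤ) (x : ℝ), (fourier n (x : AddCircle (2 * Real.pi)) : ℂ)
      = Complex.exp (Complex.I * n * x) := by
    intro n x
    rw [fourier_coe_apply]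
    congr 1
    push_cast
    field_simp
  have hc : fourierCoeff (⇑(⟨_, hcont⟩ : C(AddCircle (2 * Real.pi), ℂ))) = fourierSeq g := by
    ext n
    rw [fourierCoeff_eq_intervalIntegral _ n 0, fourierSeq]
    simp only [zero_add, he, ContinuousMap.coe_mk, Function.Periodic.lift_coe, smul_eq_mul,
      Complex.real_smul]
    push_cast
    rfl
  ext x
  have h := has_pointwise_sum_fourier_series_of_summable (f := ⟨_, hcont⟩)
    (by rw [hc]; exact (rapidDecay_fourierSeq hg).summable_norm.of_norm) x
  rw [hc] at h
  simp only [he, ContinuousMap.coe_mk, Function.Periodic.lift_coe, smul_eq_mul] at h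
  exact h.tsum_eq

end FourierSeries

/-! ### The Gaussian vector field in the angle variable -/

section GaussianField

open scoped ContDiff

theorem one_add_cos_ne_zero {θ : ℝ} (h : Real.cos (θ / 2) ≠ 0) : 1 + Real.cos θ ≠ 0 := by
  rw [one_add_cos_eq]; positivity

theorem sin_eq_tan_half_mul {θ : ℝ} (h : Real.cos (θ / 2) ≠ 0) :
    Real.sin θ = Real.tan (θ / 2) * (1 + Real.cos θ) := by
  rw [one_add_cos_eq, Real.tan_eq_sin_div_cos]
  nth_rw 1 [show θ = 2 * (θ / 2) by ring]
  rw [Real.sin_two_mul]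
  field_simp

theorem inv_one_add_cos {θ : ℝ} (h : Real.cos (θ / 2) ≠ 0) :
    (1 + Real.cos θ)⁻¹ = (1 + Real.tan (θ / 2) ^ 2) / 2 := by
  rw [one_add_cos_eq, Real.tan_eq_sin_div_cos, div_pow, Real.sin_sq]
  field_simp
  ring

theorem hasDerivAt_tan_half {θ : ℝ} (h : Real.cos (θ / 2) ≠ 0) :
    HasDerivAt (fun x => Real.tan (x / 2)) (1 + Real.cos θ)⁻¹ θ := by
  have h1 := (Real.hasDerivAt_tan h).comp θ ((hasDerivAt_id θ).div_const 2)
  refine h1.congr_deriv ?_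
  rw [one_add_cos_eq]
  field_simp

theorem eventually_cos_half_ne_zero {θ : ℝ} (h : Real.cos (θ / 2) ≠ 0) :
    ∀ᶠ x in nhds θ, Real.cos (x / 2) ≠ 0 :=
  (by fun_prop : Continuous fun x : ℝ => Real.cos (x / 2)).continuousAt.eventually_ne h

theorem ae_cos_half_ne_zero : ∀ᵐ θ : ℝ, Real.cos (θ / 2) ≠ 0 := by
  have h : {θ : ℝ | Real.cos (θ / 2) = 0} ⊆
      Set.range fun k : ℤ => (2 * k + 1) * Real.pi := by
    intro θ hθ
    obtain ⟨k, hk⟩ := Real.cos_eq_zero_iff.1 hθ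
    exact ⟨k, by linarith⟩
  have := ((Set.countable_range _).mono h).measure_zero volume
  rw [ae_iff]
  simpa using this

theorem hasDerivAt_gaussian (τ v : ℝ) :
    HasDerivAt (gaussian τ) (-(2 / τ ^ 2) * v * gaussian τ v) v := by
  have h : HasDerivAt (fun v : ℝ => -v ^ 2 / τ ^ 2) (-(2 * v) / τ ^ 2) v := by
    simpa using ((hasDerivAt_pow 2 v).neg).div_const (τ ^ 2)
  refine (h.exp.div_const (τ * √Real.pi)).congr_deriv ?_
  rw [gaussian]
  ring

/-- The function `f / (1 + cos θ) ^ m` on the circle, for the Gaussian `f` of width `τ` on the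
line. -/
def flat (τ : ℝ) (m : ℕ) (θ : ℝ) : ℝ := gaussian τ (Real.tan (θ / 2)) / (1 + Real.cos θ) ^ m

variable {τ : ℝ}

theorem gaussian_pos (hτ : 0 < τ) (v : ℝ) : 0 < gaussian τ v := by
  rw [gaussian]; positivity

theorem flat_of_cos_eq_zero {m : ℕ} (hm : m ≠ 0) {θ : ℝ} (h : Real.cos (θ / 2) = 0) :
    flat τ m θ = 0 := by
  simp [flat, one_add_cos_eq, h, hm]

/-- With `x = τ² cos²(θ/2)` one has `-v²/τ² = 1/τ² - 1/x`, and powers of `1/(1 + cos θ)` are powers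
of `1/x`, which the flat function absorbs; this gives smoothness across `θ = π`. At that point `tan`
has the default value `0`, and the left side vanishes only through division by `0 ^ m`, hence `m ≠
0`. -/
theorem flat_eq (hτ : 0 < τ) {m : ℕ} (hm : m ≠ 0) (θ : ℝ) :
    flat τ m θ = Real.exp (1 / τ ^ 2) * (τ ^ 2 / 2) ^ m / (τ * √Real.pi) *
      (((Polynomial.X : Polynomial ℝ) ^ m).eval (τ ^ 2 * Real.cos (θ / 2) ^ 2)⁻¹ *
        expNegInvGlue (τ ^ 2 * Real.cos (θ / 2) ^ 2)) := by
  by_cases h : Real.cos (θ / 2) = 0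
  · simp [flat_of_cos_eq_zero hm, h, hm]
  · have hp : 0 < τ ^ 2 * Real.cos (θ / 2) ^ 2 := by positivity
    have he : Real.exp (-Real.tan (θ / 2) ^ 2 / τ ^ 2)
        = Real.exp (1 / τ ^ 2) * Real.exp (-(τ ^ 2 * Real.cos (θ / 2) ^ 2)⁻¹) := by
      rw [← Real.exp_add]
      congr 1
      rw [Real.tan_eq_sin_div_cos, div_pow, Real.sin_sq]
      field_simp
      ring
    rw [flat, gaussian, expNegInvGlue, if_neg (not_le.2 hp), he, one_add_cos_eq, Polynomial.eval_pow,
      Polynomial.eval_X, show (τ ^ 2 / 2) ^ m = (τ ^ 2 * Real.cos (θ / 2) ^ 2) ^ m /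
        (2 * Real.cos (θ / 2) ^ 2) ^ m by rw [← div_pow]; congr 1; field_simp, inv_pow]
    field_simp

theorem flat_contDiff (hτ : 0 < τ) {m : ℕ} (hm : m ≠ 0) : ContDiff ℝ ∞ (flat τ m) := by
  rw [funext (flat_eq hτ hm)]
  exact contDiff_const.mul
    ((expNegInvGlue.contDiff_polynomial_eval_inv_mul _).comp (by fun_prop))

theorem flat_periodic (m : ℕ) : Function.Periodic (flat τ m) (2 * Real.pi) := fun θ => by
  have h : (θ + 2 * Real.pi) / 2 = θ / 2 + Real.pi := by ring
  simp only [flat, Real.cos_add_two_pi, h, Real.tan_add_pi]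

theorem ofReal_mem {g : ℝ → ℝ} (h : ContDiff ℝ ∞ g) (hp : Function.Periodic g (2 * Real.pi)) :
    (fun θ => (g θ : ℂ)) ∈ circleFn :=
  ⟨Complex.ofRealCLM.contDiff.comp h, fun θ => by simp only [hp θ]⟩

theorem flat_mem (hτ : 0 < τ) {m : ℕ} (hm : m ≠ 0) : (fun θ => (flat τ m θ : ℂ)) ∈ circleFn :=
  ofReal_mem (flat_contDiff hτ hm) (flat_periodic m)

theorem hasDerivAt_flat (m : ℕ) {θ : ℝ} (h : Real.cos (θ / 2) ≠ 0) :
    HasDerivAt (flat τ m) (flat τ m θ *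
      (m * Real.tan (θ / 2) - 2 / τ ^ 2 * Real.tan (θ / 2) * (1 + Real.cos θ)⁻¹)) θ := by
  have h0 := one_add_cos_ne_zero h
  have h1 := (hasDerivAt_gaussian τ (Real.tan (θ / 2))).comp θ (hasDerivAt_tan_half h)
  have h2 := ((Real.hasDerivAt_cos θ).const_add 1).pow m
  refine (h1.div h2 (pow_ne_zero m h0)).congr_deriv ?_
  simp only [Function.comp, flat, sin_eq_tan_half_mul h]
  rcases m with _ | m
  · simp; ring
  · simp only [Nat.add_sub_cancel, Pi.pow_apply]
    field_simp
    push_cast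
    ring

theorem toCircle_gaussian_flat (θ : ℝ) :
    toCircle (fun v => (gaussian τ v : ℂ)) θ = (((1 + Real.cos θ) ^ 2 * flat τ 1 θ : ℝ) : ℂ) := by
  by_cases h : Real.cos (θ / 2) = 0
  · simp [toCircle, one_add_cos_eq, h]
  · have h0 := one_add_cos_ne_zero h
    rw [toCircle, ← Complex.ofReal_mul, flat]
    congr 1
    field_simp

theorem integral_gaussian_eq_one (hτ : 0 < τ) : ∫ v, gaussian τ v = 1 := by
  have h := integral_gaussian (1 / τ ^ 2)
  have he : ∀ v : ℝ, gaussian τ v = Real.exp (-(1 / τ ^ 2) * v ^ 2) / (τ * √Real.pi) := by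
    intro v
    rw [gaussian]
    congr 2
    ring
  simp_rw [he]
  rw [integral_div, h, div_div_eq_mul_div, div_one, Real.sqrt_mul Real.pi_pos.le,
    Real.sqrt_sq hτ.le]
  field_simp

/-- Since `dv = dθ/(1 + cos θ)`, this is the normalisation of the Gaussian on the line. It fixes the
constant Fourier mode, from which all constants of the frequency splitting come. -/
theorem integral_flat_one (hτ : 0 < τ) : ∫ θ in (0 : ℝ)..(2 * Real.pi), flat τ 1 θ = 1 := by
  have hp := (flat_periodic (τ := τ) 1).intervalIntegral_add_eq 0 (-Real.pi)
  have hc : ∀ θ ∈ Set.Ioo (-Real.pi) Real.pi, Real.cos (θ / 2) ≠ 0 := fun θ hθ =>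
    (Real.cos_pos_of_mem_Ioo ⟨by linarith [hθ.1], by linarith [hθ.2]⟩).ne'
  have him : (fun θ : ℝ => Real.tan (θ / 2)) '' Set.Ioo (-Real.pi) Real.pi = Set.univ := by
    refine Set.eq_univ_of_forall fun v => ⟨2 * Real.arctan v, ⟨?_, ?_⟩, ?_⟩
    · linarith [Real.neg_pi_div_two_lt_arctan v]
    · linarith [Real.arctan_lt_pi_div_two v]
    · simp
  have hinj : Set.InjOn (fun θ : ℝ => Real.tan (θ / 2)) (Set.Ioo (-Real.pi) Real.pi) := by
    intro x hx y hy hxy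
    have := Real.injOn_tan ⟨by linarith [hx.1], by linarith [hx.2]⟩
      (⟨by linarith [hy.1], by linarith [hy.2]⟩ : y / 2 ∈ Set.Ioo (-(Real.pi / 2)) (Real.pi / 2)) hxy
    linarith
  have h := integral_image_eq_integral_abs_deriv_smul measurableSet_Ioo
    (fun x hx => (hasDerivAt_tan_half (hc x hx)).hasDerivWithinAt) hinj (gaussian τ)
  rw [him, Measure.restrict_univ, integral_gaussian_eq_one hτ] at h
  rw [zero_add] at hp
  rw [hp, show -Real.pi + 2 * Real.pi = Real.pi by ring,
    intervalIntegral.integral_of_le (by linarith [Real.pi_pos]), integral_Ioc_eq_integral_Ioo, h]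
  refine setIntegral_congr_fun measurableSet_Ioo fun θ hθ => ?_
  have : 0 ≤ (1 + Real.cos θ)⁻¹ := inv_nonneg.2 (by linarith [Real.neg_one_le_cos θ])
  simp only [flat, smul_eq_mul, pow_one, abs_of_nonneg this]
  ring

theorem sum_exp_modes (X : ℤ → ℂ) (θ : ℝ) :
    ∑ s ∈ Finset.Icc (-2 : ℤ) 2, Complex.exp (Complex.I * s * θ) * X s
      = X 0 + (X 1 + X (-1)) * Real.cos θ + Complex.I * (X 1 - X (-1)) * Real.sin θ
        + (X 2 + X (-2)) * (2 * Real.cos θ ^ 2 - 1)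
        + Complex.I * (X 2 - X (-2)) * (2 * Real.sin θ * Real.cos θ) := by
  have e : ∀ s : ℤ, Complex.exp (Complex.I * s * θ)
      = Complex.cos (s * θ) + Complex.sin (s * θ) * Complex.I := by
    intro s
    rw [← Complex.exp_mul_I]
    congr 1
    ring
  rw [show Finset.Icc (-2 : ℤ) 2 = {-2, -1, 0, 1, 2} from rfl]
  simp only [e]
  simp [Complex.cos_two_mul, Complex.sin_two_mul]
  ring

/-- Coefficients of `(1 + cos θ) ^ 2`. -/
def sqCoeff (s : ℤ) : ℂ := if s = 0 then 3 / 2 else if s.natAbs = 1 then 1 else 1 / 4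

/-- Coefficients of `- sin θ (1 + cos θ - σ)`. -/
def sinCoeff (σ : ℂ) (s : ℤ) : ℂ :=
  if s = 0 then 0 else if s.natAbs = 1 then Complex.I * s * (1 - σ) / 2 else Complex.I * s / 8

theorem modeSum_band_sq {a : ℤ → ℂ} (ha : RapidDecay a) (σ : ℂ) (θ : ℝ) :
    modeSum (band sqCoeff (sinCoeff σ) a) θ = (1 + Real.cos θ) ^ 2 * deriv (modeSum a) θ
      - Real.sin θ * (1 + Real.cos θ - σ) * modeSum a θ := by
  rw [ha.modeSum_band, sum_exp_modes]
  simp [sqCoeff, sinCoeff]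
  ring_nf
  simp only [Complex.I_sq]
  ring

theorem modeSum_band_mul_sq {a : ℤ → ℂ} (ha : RapidDecay a) (θ : ℝ) :
    modeSum (band 0 sqCoeff a) θ = (1 + Real.cos θ) ^ 2 * modeSum a θ := by
  rw [ha.modeSum_band, sum_exp_modes]
  simp [sqCoeff]
  ring

theorem modeSum_band_mul_sin {a : ℤ → ℂ} (ha : RapidDecay a) (θ : ℝ) :
    modeSum (band 0 (sinCoeff 0) a) θ = -(Real.sin θ * (1 + Real.cos θ)) * modeSum a θ := by
  rw [ha.modeSum_band, sum_exp_modes]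
  simp [sinCoeff]
  ring_nf
  simp only [Complex.I_sq]
  ring

theorem band_eq (p r a : ℤ → ℂ) (n : ℤ) : band p r a n =
    (p (-2) * (Complex.I * (n + 2)) + r (-2)) * a (n + 2)
    + (p (-1) * (Complex.I * (n + 1)) + r (-1)) * a (n + 1)
    + (p 0 * (Complex.I * n) + r 0) * a n
    + (p 1 * (Complex.I * (n - 1)) + r 1) * a (n - 1)
    + (p 2 * (Complex.I * (n - 2)) + r 2) * a (n - 2) := by
  rw [band, show Finset.Icc (-2 : ℤ) 2 = {-2, -1, 0, 1, 2} from rfl]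
  simp
  ring

/-- Multiplier of the projection to the positive modes that takes half of the constant mode. -/
def posCut (n : ℤ) : ℂ := if 0 < n then 1 else if n = 0 then 1 / 2 else 0

theorem rapidDecay_posCut {a : ℤ → ℂ} (ha : RapidDecay a) : RapidDecay fun n => posCut n * a n := by
  refine ha.mono 1 fun n => ?_
  rw [norm_mul]
  gcongr
  rw [posCut]
  split_ifs <;> norm_num

/-- The constant function as a mode sequence. -/
def delta (n : ℤ) : ℂ := if n = 0 then 1 else 0

theorem rapidDecay_delta : RapidDecay delta := fun k => by
  refine summable_of_ne_finset_zero (s := {0}) fun n hn => ?_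
  simp only [Finset.mem_singleton] at hn
  simp [delta, hn]

theorem modeSum_delta (θ : ℝ) : modeSum delta θ = 1 := by
  rw [modeSum, tsum_eq_single 0 (fun n hn => by simp [delta, hn])]
  simp [delta]

end GaussianField

/-! ### Splitting the Gaussian field into frequency parts -/

section FrequencySplitting

open scoped ContDiff

variable {τ : ℝ}

/-- The equation `f' = -σ v f` in the angle variable, cleared of denominators so that its
coefficients are trigonometric polynomials of degree two. -/
theorem flat_ode (hτ : 0 < τ) (θ : ℝ) :
    (1 + Real.cos θ : ℂ) ^ 2 * deriv (fun θ => (flat τ 1 θ : ℂ)) θ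
      - Real.sin θ * (1 + Real.cos θ - 2 / τ ^ 2) * flat τ 1 θ = 0 := by
  by_cases h : Real.cos (θ / 2) = 0
  · have h1 : (1 + Real.cos θ : ℂ) = 0 := by
      exact_mod_cast (by rw [one_add_cos_eq, h]; simp : 1 + Real.cos θ = 0)
    rw [h1, flat_of_cos_eq_zero one_ne_zero h]
    simp
  · have h0 := one_add_cos_ne_zero h
    rw [(hasDerivAt_flat 1 h).ofReal_comp.deriv]
    norm_cast
    rw [sin_eq_tan_half_mul h]
    field_simp
    ring

/-- The Fourier coefficients of `f / (1 + cos θ)`. -/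
def flatSeq (τ : ℝ) : ℤ → ℂ := fourierSeq fun θ => (flat τ 1 θ : ℂ)

theorem rapidDecay_flatSeq (hτ : 0 < τ) : RapidDecay (flatSeq τ) :=
  rapidDecay_fourierSeq (flat_mem hτ one_ne_zero)

theorem modeSum_flatSeq (hτ : 0 < τ) : modeSum (flatSeq τ) = fun θ => (flat τ 1 θ : ℂ) :=
  modeSum_fourierSeq (flat_mem hτ one_ne_zero)

theorem flatSeq_zero (hτ : 0 < τ) : flatSeq τ 0 = 1 / (2 * Real.pi) := by
  have h : ∫ θ in (0 : ℝ)..(2 * Real.pi), (flat τ 1 θ : ℂ) = 1 := by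
    rw [intervalIntegral.integral_ofReal, integral_flat_one hτ, Complex.ofReal_one]
  simp [flatSeq, fourierSeq, h]

theorem band_flatSeq (hτ : 0 < τ) : band sqCoeff (sinCoeff (2 / τ ^ 2)) (flatSeq τ) = 0 := by
  have ha := rapidDecay_flatSeq hτ
  refine (ha.band _ _).ext (fun k => by simp) fun θ => ?_
  rw [modeSum_band_sq ha, modeSum_flatSeq hτ]
  simpa [modeSum] using flat_ode hτ θ

/-- The positive frequency part of `f / (1 + cos θ)`. -/
def posSeq (τ : ℝ) (n : ℤ) : ℂ := posCut n * flatSeq τ n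

theorem rapidDecay_posSeq (hτ : 0 < τ) : RapidDecay (posSeq τ) :=
  rapidDecay_posCut (rapidDecay_flatSeq hτ)

theorem posSeq_of_pos {n : ℤ} (h : 0 < n) : posSeq τ n = flatSeq τ n := by
  simp [posSeq, posCut, h]

theorem posSeq_of_neg {n : ℤ} (h : n < 0) : posSeq τ n = 0 := by
  simp [posSeq, posCut, h.not_gt, h.ne]

theorem posSeq_zero : posSeq τ 0 = flatSeq τ 0 / 2 := by
  simp [posSeq, posCut]; ring

/-- Cutting the recurrence `band_flatSeq` at frequency zero leaves a defect only where the band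
meets the cut, in the modes `|n| ≤ 2`. Taking half of the constant mode makes the defect even in
`n`, so it is a cosine polynomial whose modes `±1`, `±2` depend only on the constant coefficient
`1/(2π)`. -/
theorem posSeq_ode (hτ : 0 < τ) (θ : ℝ) :
    (1 + Real.cos θ : ℂ) ^ 2 * deriv (modeSum (posSeq τ)) θ
      - Real.sin θ * (1 + Real.cos θ - 2 / τ ^ 2) * modeSum (posSeq τ) θ
      = -(Complex.I / (4 * Real.pi)) * ((1 + Real.cos θ) * (Real.cos θ - 2 / τ ^ 2)) := by
  have hb := rapidDecay_posSeq hτ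
  have h0 := band_flatSeq hτ
  set σ : ℂ := 2 / τ ^ 2
  set b := band sqCoeff (sinCoeff σ) (posSeq τ) with hbdef
  -- Below the band every coefficient involved has been cut away; above it none has, and the full
  -- recurrence applies.
  have hz : ∀ n ∉ Finset.Icc (-2 : ℤ) 2, b n = 0 := by
    intro n hn
    rw [Finset.mem_Icc, not_and_or, not_le, not_le] at hn
    rcases hn with hn | hn
    · rw [hbdef, band_eq]
      simp only [posSeq_of_neg (show n + 2 < 0 by omega), posSeq_of_neg (show n + 1 < 0 by omega),
        posSeq_of_neg (show n < 0 by omega), posSeq_of_neg (show n - 1 < 0 by omega),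
        posSeq_of_neg (show n - 2 < 0 by omega)]
      ring
    · have h := congrFun h0 n
      rw [band_eq] at h
      rw [hbdef, band_eq]
      simpa only [posSeq_of_pos (show 0 < n + 2 by omega), posSeq_of_pos (show 0 < n + 1 by omega),
        posSeq_of_pos (show 0 < n by omega), posSeq_of_pos (show 0 < n - 1 by omega),
        posSeq_of_pos (show 0 < n - 2 by omega), Pi.zero_apply] using h
  have hneg : ∀ m : ℕ, posSeq τ (-(m + 1 : ℕ)) = 0 := fun m => posSeq_of_neg (by omega)
  have hm1 : posSeq τ (-1) = 0 := hneg 0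
  have hm2 : posSeq τ (-2) = 0 := hneg 1
  have hm3 : posSeq τ (-3) = 0 := hneg 2
  have hm4 : posSeq τ (-4) = 0 := hneg 3
  have b2 : b 2 = -(Complex.I / 8) * flatSeq τ 0 := by
    have h := congrFun h0 2
    rw [band_eq] at h
    rw [hbdef, band_eq]
    simp only [Int.reduceAdd, Int.reduceSub, posSeq_zero, posSeq_of_pos (show (0 : ℤ) < 1 by decide),
      posSeq_of_pos (show (0 : ℤ) < 2 by decide), posSeq_of_pos (show (0 : ℤ) < 3 by decide),
      posSeq_of_pos (show (0 : ℤ) < 4 by decide)] at h ⊢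
    simp [sqCoeff, sinCoeff] at h ⊢
    linear_combination h
  have b1 : b 1 = -(Complex.I * (1 - σ) / 4) * flatSeq τ 0 := by
    have h := congrFun h0 1
    rw [band_eq] at h
    rw [hbdef, band_eq]
    simp only [Int.reduceAdd, Int.reduceSub, posSeq_zero, posSeq_of_pos (show (0 : ℤ) < 1 by decide),
      posSeq_of_pos (show (0 : ℤ) < 2 by decide), posSeq_of_pos (show (0 : ℤ) < 3 by decide),
      hm1, sub_self] at h ⊢
    simp [sqCoeff, sinCoeff] at h ⊢
    linear_combination h
  have bm2 : b (-2) = -(Complex.I / 8) * flatSeq τ 0 := by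
    rw [hbdef, band_eq]
    simp only [Int.reduceAdd, Int.reduceSub, Int.reduceNeg, posSeq_zero, hm1, hm2, hm3, hm4]
    simp [sqCoeff, sinCoeff]
    ring
  have bm1 : b (-1) = -(Complex.I * (1 - σ) / 4) * flatSeq τ 0 := by
    rw [hbdef, band_eq]
    simp only [Int.reduceAdd, Int.reduceSub, Int.reduceNeg, posSeq_zero, hm1, hm2, hm3]
    simp [sqCoeff, sinCoeff]
    ring
  have hsum : ∀ θ : ℝ, modeSum b θ = b 0 - Complex.I * (1 - σ) / 2 * flatSeq τ 0 * Real.cos θ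
      - Complex.I / 4 * flatSeq τ 0 * (2 * Real.cos θ ^ 2 - 1) := by
    intro θ
    rw [modeSum, tsum_eq_sum (s := Finset.Icc (-2 : ℤ) 2) fun n hn => by rw [hz n hn, zero_mul]]
    simp_rw [mul_comm (b _)]
    rw [sum_exp_modes, b1, b2, bm1, bm2]
    ring
  -- At `θ = π` both coefficients of the differential operator vanish, which determines the
  -- remaining mode `b 0`.
  have hpi := modeSum_band_sq hb σ Real.pi
  rw [← hbdef, hsum, Real.cos_pi, Real.sin_pi] at hpi
  push_cast at hpi
  rw [← modeSum_band_sq hb, ← hbdef, hsum]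
  rw [flatSeq_zero hτ] at hpi ⊢
  have hπ : (Real.pi : ℂ) ≠ 0 := by exact_mod_cast Real.pi_ne_zero
  field_simp at hpi ⊢
  linear_combination hpi

/-- The coefficients of the positive frequency part of the Gaussian vector field. -/
def posFieldSeq (τ : ℝ) (n : ℤ) : ℂ :=
  band 0 sqCoeff (posSeq τ) n + -(Complex.I / (4 * Real.pi)) * band 0 (sinCoeff 0) delta n

theorem rapidDecay_posFieldSeq (hτ : 0 < τ) : RapidDecay (posFieldSeq τ) :=
  ((rapidDecay_posSeq hτ).band _ _).add ((rapidDecay_delta.band _ _).const_mul _)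

theorem modeSum_const_mul {a : ℤ → ℂ} (z : ℂ) (θ : ℝ) :
    modeSum (fun n => z * a n) θ = z * modeSum a θ := by
  simp_rw [modeSum, mul_assoc, tsum_mul_left]

theorem modeSum_posFieldSeq (hτ : 0 < τ) (θ : ℝ) :
    modeSum (posFieldSeq τ) θ = (1 + Real.cos θ) ^ 2 * modeSum (posSeq τ) θ
      + Complex.I / (4 * Real.pi) * (Real.sin θ * (1 + Real.cos θ)) := by
  have h := ((rapidDecay_posSeq hτ).band 0 sqCoeff).modeSum_add
    ((rapidDecay_delta.band 0 (sinCoeff 0)).const_mul (-(Complex.I / (4 * Real.pi)))) θ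
  rw [modeSum_band_mul_sq (rapidDecay_posSeq hτ), modeSum_const_mul,
    modeSum_band_mul_sin rapidDecay_delta, modeSum_delta] at h
  refine h.trans ?_
  ring

/-- The positive frequency part of the Gaussian vector field. -/
def posField (hτ : 0 < τ) : circleFn :=
  ⟨modeSum (posFieldSeq τ), (rapidDecay_posFieldSeq hτ).modeSum_mem⟩

/-- The Gaussian vector field on the circle. -/
def gaussField (hτ : 0 < τ) : circleFn := ⟨toCircle (gaussianFn hτ).1, (gaussianFn hτ).2⟩

theorem gaussField_apply (hτ : 0 < τ) (θ : ℝ) :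
    (gaussField hτ).1 θ = (1 + Real.cos θ) ^ 2 * flat τ 1 θ := by
  refine (toCircle_gaussian_flat θ).trans ?_
  push_cast
  rfl

/-- The factor `(1 + cos θ)²` spreads the constant term of the cut function to the mode `-2`; the
correction `(i/4π) sin θ (1 + cos θ)` cancels exactly this. The mode `-1` may remain, as it
annihilates the vacuum. -/
theorem fourierSeq_posField (hτ : 0 < τ) {n : ℤ} (hn : n < -1) :
    fourierSeq (posField hτ).1 n = 0 := by
  rw [posField, (rapidDecay_posFieldSeq hτ).fourierSeq_modeSum, posFieldSeq, band_eq, band_eq]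
  rcases lt_or_eq_of_le (show n ≤ -2 by omega) with h | rfl
  · simp only [posSeq_of_neg (show n + 2 < 0 by omega), posSeq_of_neg (show n + 1 < 0 by omega),
        posSeq_of_neg (show n < 0 by omega), posSeq_of_neg (show n - 1 < 0 by omega),
        posSeq_of_neg (show n - 2 < 0 by omega), delta, (show n + 2 ≠ 0 by omega),
        (show n + 1 ≠ 0 by omega), (show n ≠ 0 by omega), (show n - 1 ≠ 0 by omega),
        (show n - 2 ≠ 0 by omega), if_false]
    ring
  · have hneg : ∀ m : ℕ, posSeq τ (-(m + 1 : ℕ)) = 0 := fun m => posSeq_of_neg (by omega)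
    have hm1 : posSeq τ (-1) = 0 := hneg 0
    have hm2 : posSeq τ (-2) = 0 := hneg 1
    have hm3 : posSeq τ (-3) = 0 := hneg 2
    have hm4 : posSeq τ (-4) = 0 := hneg 3
    simp [hm1, hm2, hm3, hm4, posSeq_zero, delta, sqCoeff, sinCoeff, flatSeq_zero hτ]
    have hπ : (Real.pi : ℂ) ≠ 0 := by exact_mod_cast Real.pi_ne_zero
    field_simp
    ring_nf
    simp only [Complex.I_sq]
    ring

/-- The constant mode was split evenly, so the same correction, now subtracted, also cancels the
mode `2` of the complementary part. -/
theorem fourierSeq_negField (hτ : 0 < τ) {n : ℤ} (hn : 1 < n) :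
    fourierSeq (gaussField hτ - posField hτ).1 n = 0 := by
  have ha := rapidDecay_flatSeq hτ
  have hb := rapidDecay_posFieldSeq hτ
  have he : (gaussField hτ - posField hτ).1
      = modeSum fun n => band 0 sqCoeff (flatSeq τ) n + -1 * posFieldSeq τ n := by
    ext θ
    rw [(ha.band 0 sqCoeff).modeSum_add (hb.const_mul (-1)), modeSum_const_mul,
      modeSum_band_mul_sq ha, modeSum_flatSeq hτ]
    change (gaussField hτ).1 θ - _ = _
    rw [gaussField_apply]
    simp [posField]
    ring
  rw [he, ((ha.band 0 sqCoeff).add (hb.const_mul (-1))).fourierSeq_modeSum]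
  simp only [posFieldSeq, band_eq]
  rcases lt_or_eq_of_le (show 2 ≤ n by omega) with h | rfl
  · simp only [posSeq_of_pos (show 0 < n + 2 by omega), posSeq_of_pos (show 0 < n + 1 by omega),
        posSeq_of_pos (show 0 < n by omega), posSeq_of_pos (show 0 < n - 1 by omega),
        posSeq_of_pos (show 0 < n - 2 by omega), delta, (show n + 2 ≠ 0 by omega),
        (show n + 1 ≠ 0 by omega), (show n ≠ 0 by omega), (show n - 1 ≠ 0 by omega),
        (show n - 2 ≠ 0 by omega), if_false]
    ring
  · simp [posSeq_of_pos, posSeq_zero, delta, sqCoeff, sinCoeff, flatSeq_zero hτ]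
    have hπ : (Real.pi : ℂ) ≠ 0 := by exact_mod_cast Real.pi_ne_zero
    field_simp
    ring_nf
    simp only [Complex.I_sq]
    ring

/-- In the line coordinate this reads `f₊' + (2/τ²) v f₊ = i/(πτ²)`. The correction term of
`posField` turns the right side of `posSeq_ode` into a multiple of `(1 + cos θ)²`. -/
theorem posField_ode (hτ : 0 < τ) (θ : ℝ) :
    (1 + Real.cos θ : ℂ) ^ 2 * deriv (posField hτ).1 θ
      + Real.sin θ * (1 + Real.cos θ + 2 / τ ^ 2) * (posField hτ).1 θ
      = Complex.I / (Real.pi * τ ^ 2) * (1 + Real.cos θ) ^ 2 := by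
  have hb := rapidDecay_posSeq hτ
  have hd := (hb.hasDerivAt θ)
  have hc : HasDerivAt (fun x : ℝ => (1 + Real.cos x : ℂ)) (-Real.sin θ : ℂ) θ := by
    simpa using ((Real.hasDerivAt_cos θ).ofReal_comp.const_add (1 : ℂ))
  have hs : HasDerivAt (fun x : ℝ => (Real.sin x : ℂ)) (Real.cos θ : ℂ) θ :=
    (Real.hasDerivAt_sin θ).ofReal_comp
  have h1 := ((hc.pow 2).mul hd).add ((hs.mul hc).const_mul (Complex.I / (4 * Real.pi)))
  have he : (posField hτ).1 = fun x : ℝ => (1 + Real.cos x : ℂ) ^ 2 * modeSum (posSeq τ) x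
      + Complex.I / (4 * Real.pi) * (Real.sin x * (1 + Real.cos x)) :=
    funext (modeSum_posFieldSeq hτ)
  have h2 := posSeq_ode hτ θ
  rw [hd.deriv] at h2
  rw [he, (show HasDerivAt (fun x : ℝ => (1 + Real.cos x : ℂ) ^ 2 * modeSum (posSeq τ) x
    + Complex.I / (4 * Real.pi) * (Real.sin x * (1 + Real.cos x))) _ θ from h1).deriv]
  have hsc : (Real.sin θ : ℂ) ^ 2 = 1 - Real.cos θ ^ 2 := by
    exact_mod_cast Real.sin_sq θ
  have hπ : (Real.pi : ℂ) ≠ 0 := by exact_mod_cast Real.pi_ne_zero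
  have hτ' : (τ : ℂ) ≠ 0 := by exact_mod_cast hτ.ne'
  simp only [Pi.pow_apply, Nat.add_one_sub_one, Nat.cast_ofNat, pow_one]
  generalize (Real.sin θ : ℂ) = s at *
  generalize (Real.cos θ : ℂ) = c at *
  generalize modeSum (posSeq τ) θ = m at *
  generalize modeSum (fun n => Complex.I * n * posSeq τ n) θ = m' at *
  field_simp at h2 ⊢
  linear_combination (1 + c) ^ 2 * h2 + hsc * (2 * Complex.I * (1+c))

end FrequencySplitting

/-! ### Bracket and central term of the Gaussian field with its positive part -/

section CentralTerm

open scoped ContDiff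

variable {τ : ℝ}

theorem differentiableAt_circleFn (F : circleFn) (θ : ℝ) : DifferentiableAt ℝ F.1 θ :=
  F.2.1.differentiable (by simp) θ

theorem hasDerivAt_gaussField (hτ : 0 < τ) (θ : ℝ) :
    HasDerivAt (gaussField hτ).1
      (-(Real.sin θ * (1 + Real.cos θ + 2 / τ ^ 2) * flat τ 1 θ) : ℂ) θ := by
  have hd := ((flat_mem hτ one_ne_zero).1.differentiable (by simp) θ).hasDerivAt
  have hc : HasDerivAt (fun x : ℝ => (1 + Real.cos x : ℂ)) (-Real.sin θ : ℂ) θ := by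
    simpa using ((Real.hasDerivAt_cos θ).ofReal_comp.const_add (1 : ℂ))
  have h1 := (hc.pow 2).mul hd
  have h2 := flat_ode hτ θ
  rw [show (gaussField hτ).1 = _ from funext (gaussField_apply hτ)]
  refine h1.congr_deriv ?_
  simp only [Pi.pow_apply, Nat.add_one_sub_one, Nat.cast_ofNat, pow_one]
  linear_combination h2

/-- The Gaussian field solves the homogeneous form of `posField_ode`, so in this Wronskian only the
inhomogeneous term survives. -/
theorem bracket_posField (hτ : 0 < τ) :
    bracket (posField hτ) (gaussField hτ) = (Complex.I / (Real.pi * τ ^ 2)) • gaussField hτ := by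
  ext θ
  change deriv (posField hτ).1 θ * (gaussField hτ).1 θ - (posField hτ).1 θ *
    deriv (gaussField hτ).1 θ = Complex.I / (Real.pi * τ ^ 2) * (gaussField hτ).1 θ
  rw [(hasDerivAt_gaussField hτ θ).deriv, gaussField_apply]
  linear_combination (flat τ 1 θ : ℂ) * posField_ode hτ θ

theorem hasDerivAt_deriv_of_eventually {g D : ℝ → ℂ} {D' : ℂ} {θ : ℝ}
    (h : ∀ᶠ x in nhds θ, HasDerivAt g (D x) x) (hD : HasDerivAt D D' θ) :
    HasDerivAt (deriv g) D' θ :=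
  hD.congr_of_eventuallyEq (h.mono fun _ hx => hx.deriv)

/-- A primitive of the density of the central term, up to a multiple of `f / (1 + cos θ)`. -/
def centralPrimitive (hτ : 0 < τ) (θ : ℝ) : ℂ :=
  ((2 / τ ^ 2) ^ 2 / 2 * ((1 - Real.cos θ) * flat τ 2 θ) - 2 / τ ^ 2 * flat τ 1 θ)
    * (posField hτ).1 θ - Complex.I / (Real.pi * τ ^ 4) * (Real.sin θ * flat τ 1 θ)

theorem centralPrimitive_mem (hτ : 0 < τ) : centralPrimitive hτ ∈ circleFn := by
  have h1 := flat_mem hτ one_ne_zero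
  have h2 := flat_mem hτ two_ne_zero
  have hc := ofReal_mem Real.contDiff_cos Real.cos_periodic
  have hs := ofReal_mem Real.contDiff_sin Real.sin_periodic
  have hone : (fun _ : ℝ => (1 : ℂ)) ∈ circleFn := ⟨contDiff_const, fun _ => rfl⟩
  exact circleFn.sub_mem (mul_mem (circleFn.sub_mem
    (circleFn.smul_mem _ (mul_mem (circleFn.sub_mem hone hc) h2)) (circleFn.smul_mem _ h1))
      (posField hτ).2) (circleFn.smul_mem _ (mul_mem hs h1))

/-- Away from `θ = π` the first-order equation eliminates all derivatives of the positive part, and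
the claim becomes a rational identity in `v = tan (θ/2)`, `flat` and the positive part itself. -/
theorem deriv_centralPrimitive (hτ : 0 < τ) {θ : ℝ} (h : Real.cos (θ / 2) ≠ 0) :
    (gaussField hτ).1 θ * (iteratedDeriv 3 (posField hτ).1 θ + deriv (posField hτ).1 θ)
      = deriv (centralPrimitive hτ) θ - Complex.I / (Real.pi * τ ^ 4) * flat τ 1 θ := by
  set F := (posField hτ).1
  set b : ℂ := Complex.I / (Real.pi * τ ^ 2) with hb
  set σ : ℂ := 2 / τ ^ 2 with hσ
  set v : ℝ → ℂ := fun x => (Real.tan (x / 2) : ℂ) with hv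
  have hw : ∀ x : ℝ, Real.cos (x / 2) ≠ 0 → ((1 + Real.cos x : ℂ))⁻¹ = (1 + v x ^ 2) / 2 := by
    intro x hx
    have := inv_one_add_cos hx
    simp only [hv]
    exact_mod_cast this
  have hne : ∀ x : ℝ, Real.cos (x / 2) ≠ 0 → (1 + v x ^ 2) ≠ 0 := by
    intro x hx
    simp only [hv]
    exact_mod_cast (by positivity : (0 : ℝ) < 1 + Real.tan (x / 2) ^ 2).ne'
  have hcos : ∀ x : ℝ, Real.cos (x / 2) ≠ 0 → (Real.cos x : ℂ) = 2 / (1 + v x ^ 2) - 1 := by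
    intro x hx
    have h1 := hw x hx
    rw [inv_eq_iff_eq_inv] at h1
    rw [eq_sub_iff_add_eq, add_comm, h1, inv_div]
  have hsin : ∀ x : ℝ, Real.cos (x / 2) ≠ 0 → (Real.sin x : ℂ) = v x * (2 / (1 + v x ^ 2)) := by
    intro x hx
    rw [show 2 / (1 + v x ^ 2) = 1 + (Real.cos x : ℂ) by rw [hcos x hx]; ring]
    simp only [hv]
    exact_mod_cast sin_eq_tan_half_mul hx
  have hdv : ∀ x : ℝ, Real.cos (x / 2) ≠ 0 → HasDerivAt v ((1 + v x ^ 2) / 2) x := by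
    intro x hx
    refine (hasDerivAt_tan_half hx).ofReal_comp.congr_deriv ?_
    rw [← hw x hx]
    push_cast
    rfl
  -- `A` is `sin θ (1 + cos θ + σ) / (1 + cos θ)²` in terms of `v`, so that the equation of the
  -- positive part reads `F' = b - A F`.
  set A : ℝ → ℂ := fun x => v x + σ / 2 * (v x + v x ^ 3) with hA
  set A1 : ℝ → ℂ := fun x => (1 + σ / 2 * (1 + 3 * v x ^ 2)) * ((1 + v x ^ 2) / 2) with hA1
  set A2 : ℝ → ℂ := fun x => (3 * σ * v x * ((1 + v x ^ 2) / 2)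
    + (1 + σ / 2 * (1 + 3 * v x ^ 2)) * v x) * ((1 + v x ^ 2) / 2) with hA2
  have hdA : ∀ x : ℝ, Real.cos (x / 2) ≠ 0 → HasDerivAt A (A1 x) x := by
    intro x hx
    have h1 := (hdv x hx).add (((hdv x hx).add ((hdv x hx).pow 3)).const_mul (σ / 2))
    refine h1.congr_deriv ?_
    simp only [hA1, Nat.add_one_sub_one, Nat.cast_ofNat]
    ring
  have hdA1 : ∀ x : ℝ, Real.cos (x / 2) ≠ 0 → HasDerivAt A1 (A2 x) x := by
    intro x hx
    have h1 := ((((((hdv x hx).pow 2).const_mul 3).const_add 1).const_mul (σ / 2)).const_add 1).mul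
      ((((hdv x hx).pow 2).const_add 1).div_const 2)
    refine h1.congr_deriv ?_
    simp only [hA2, Nat.add_one_sub_one, Nat.cast_ofNat, Pi.pow_apply]
    ring
  have hD1 : ∀ x : ℝ, Real.cos (x / 2) ≠ 0 → HasDerivAt F (b - A x * F x) x := by
    intro x hx
    refine (differentiableAt_circleFn (posField hτ) x).hasDerivAt.congr_deriv ?_
    have h1 := posField_ode hτ x
    rw [hsin x hx, hcos x hx, ← hσ, ← hb] at h1
    have := hne x hx
    change _ * deriv F x + _ * F x = _ at h1
    change deriv F x = _
    clear_value F b σ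
    simp only [hA]
    field_simp at h1 ⊢
    linear_combination h1 / 2
  have hD2 : ∀ x : ℝ, Real.cos (x / 2) ≠ 0 →
      HasDerivAt (deriv F) (-(A1 x * F x + A x * (b - A x * F x))) x := by
    intro x hx
    refine hasDerivAt_deriv_of_eventually ((eventually_cos_half_ne_zero hx).mono hD1) ?_
    exact ((hdA x hx).mul (hD1 x hx)).const_sub b
  have hD3 : HasDerivAt (deriv (deriv F)) (-(A2 θ * F θ + A1 θ * (b - A θ * F θ)
      + (A1 θ * (b - A θ * F θ) - A θ * (A1 θ * F θ + A θ * (b - A θ * F θ))))) θ := by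
    refine hasDerivAt_deriv_of_eventually ((eventually_cos_half_ne_zero h).mono hD2) ?_
    refine (((hdA1 θ h).mul (hD1 θ h)).add ((hdA θ h).mul
      (((hdA θ h).mul (hD1 θ h)).const_sub b))).neg.congr_deriv ?_
    simp only [Pi.mul_apply]
    ring
  have hF3 : iteratedDeriv 3 F θ = deriv (deriv (deriv F)) θ := by
    rw [iteratedDeriv_succ, iteratedDeriv_succ, iteratedDeriv_one]
  have hc : HasDerivAt (fun x : ℝ => (Real.cos x : ℂ)) (-Real.sin θ : ℂ) θ := by
    simpa using (Real.hasDerivAt_cos θ).ofReal_comp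
  have hs : HasDerivAt (fun x : ℝ => (Real.sin x : ℂ)) (Real.cos θ : ℂ) θ :=
    (Real.hasDerivAt_sin θ).ofReal_comp
  have hf1 := (hasDerivAt_flat (τ := τ) 1 h).ofReal_comp
  have hf2 := (hasDerivAt_flat (τ := τ) 2 h).ofReal_comp
  have hE := (((((hc.const_sub 1).mul hf2).const_mul (σ ^ 2 / 2)).sub (hf1.const_mul σ)).mul
    (hD1 θ h)).sub ((hs.mul hf1).const_mul (Complex.I / (Real.pi * τ ^ 4)))
  rw [hF3, hD3.deriv, (hD1 θ h).deriv, (show HasDerivAt (centralPrimitive hτ) _ θ from hE).deriv,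
    gaussField_apply]
  have hf : (flat τ 2 θ : ℂ) = flat τ 1 θ * ((1 + v θ ^ 2) / 2) := by
    rw [← hw θ h, flat, flat]
    push_cast
    field_simp
  have hbσ : Complex.I / (Real.pi * τ ^ 4) = σ / 2 * b := by
    rw [hb, hσ]
    have : (τ : ℂ) ≠ 0 := by exact_mod_cast hτ.ne'
    field_simp
  have hσ' : ((2 / τ ^ 2 : ℝ) : ℂ) = σ := by rw [hσ]; push_cast; rfl
  have hw' : (((1 + Real.cos θ)⁻¹ : ℝ) : ℂ) = (1 + v θ ^ 2) / 2 := by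
    rw [← hw θ h]; push_cast; rfl
  have hv' : ((Real.tan (θ / 2) : ℝ) : ℂ) = v θ := rfl
  simp only [Pi.mul_apply, hf, Complex.ofReal_sub, Complex.ofReal_mul, Pi.sub_apply,
    Nat.cast_one, Nat.cast_ofNat, Complex.ofReal_one, Complex.ofReal_ofNat]
  rw [hsin θ h, hcos θ h, hbσ, hσ', hw', hv']
  have := hne θ h
  clear_value F b σ
  simp only [hA, hA1, hA2]
  field_simp
  ring

/-- The primitive is periodic and drops out; the unit mass of `flat` leaves the constant. -/
theorem central_integral (hτ : 0 < τ) :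
    ∫ θ in (0 : ℝ)..(2 * Real.pi), (gaussField hτ).1 θ *
      (iteratedDeriv 3 (posField hτ).1 θ + deriv (posField hτ).1 θ)
      = -(Complex.I / (Real.pi * τ ^ 4)) := by
  have h : ∫ θ in (0 : ℝ)..(2 * Real.pi), (gaussField hτ).1 θ *
      (iteratedDeriv 3 (posField hτ).1 θ + deriv (posField hτ).1 θ)
      = ∫ θ in (0 : ℝ)..(2 * Real.pi), (deriv (centralPrimitive hτ) θ
        - Complex.I / (Real.pi * τ ^ 4) * flat τ 1 θ) := by
    refine intervalIntegral.integral_congr_ae ?_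
    filter_upwards [ae_cos_half_ne_zero] with θ hθ _ using deriv_centralPrimitive hτ hθ
  have hE := centralPrimitive_mem hτ
  rw [h, intervalIntegral.integral_sub ((deriv_mem hE).1.continuous.intervalIntegrable _ _)
    (((flat_mem hτ one_ne_zero).1.continuous.intervalIntegrable _ _).const_mul _),
    integral_deriv_eq_zero hE, intervalIntegral.integral_const_mul,
    intervalIntegral.integral_ofReal, integral_flat_one hτ]
  simp

end CentralTerm

/-! ### Complex conjugation and Fourier modes -/

section Conjugation

theorem fourierSeq_conjFn (F : circleFn) (n : ℤ) :
    fourierSeq (conjFn F).1 n = conj (fourierSeq F.1 (-n)) := by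
  rw [fourierSeq, fourierSeq, map_mul, intervalIntegral.integral_of_le Real.two_pi_pos.le,
    intervalIntegral.integral_of_le Real.two_pi_pos.le, ← integral_conj]
  congr 1
  · simp [(map_ofNat _ 2 : conj (2 : ℂ) = 2)]
  · refine integral_congr_ae (Filter.Eventually.of_forall fun θ => ?_)
    simp only [conjFn, map_mul, ← Complex.exp_conj, Complex.conj_I, Complex.conj_ofReal,
      map_intCast]
    congr 2
    push_cast
    ring

theorem conjFn_gaussField {τ : ℝ} (hτ : 0 < τ) : conjFn (gaussField hτ) = gaussField hτ := by
  ext θ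
  simp only [conjFn, gaussField_apply, map_mul, map_pow, map_add, map_one, Complex.conj_ofReal]

end Conjugation

/-! ### Annihilation of the vacuum and the moment recursion -/

namespace ChiralCFT

variable {H : Type*} [NormedAddCommGroup H] [InnerProductSpace ℂ H] {c : ℝ} (𝒞 : ChiralCFT H c)

theorem exists_reparametrized {ρ : ℝ → ℝ} (hρ : IsCircleDiffeo ρ) {F G : circleFn}
    (hFG : ∀ θ, G.1 (ρ θ) = ((deriv ρ θ : ℝ) : ℂ) * F.1 θ) (ψ : 𝒞.D) :
    ∃ φ : 𝒞.D, inner ℂ (φ : H) (𝒞.Θ G φ : H) = inner ℂ (ψ : H) (𝒞.Θ F ψ : H)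
      + (((c / (24 * Real.pi) : ℝ) : ℂ) *
        ∫ θ in (0 : ℝ)..(2 * Real.pi), F.1 θ * (anomaly ρ θ : ℂ)) * ((‖(ψ : H)‖ ^ 2 : ℝ) : ℂ) := by
  obtain ⟨U, hU, h⟩ := 𝒞.covariant ρ hρ
  refine ⟨⟨U ψ, (hU _).2 ψ.2⟩, ?_⟩
  have h1 := h F G hFG ψ ⟨U ψ, (hU _).2 ψ.2⟩ rfl
  rw [← LinearIsometryEquiv.inner_map_map U (ψ : H), h1, inner_sub_right,
    inner_smul_right, LinearIsometryEquiv.inner_map_map, inner_self_eq_norm_sq_to_K]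
  simp

theorem mode_zero_apply (θ : ℝ) : (mode 0).1 θ = 1 := by simp [mode]

theorem anomaly_add_const (a : ℝ) : anomaly (fun θ => θ + a) = 0 := by
  ext θ
  simp [anomaly, schwarzian, iteratedDeriv_const]

/-- From `2 = (1 + cos θ) + (1 - cos θ)`: the second summand is the first rotated by `π`, and
rotations have no anomaly. Thus `2 L₀` is the sum of the positive `P` and a unitary conjugate of it.
-/
theorem energy_nonneg (ψ : 𝒞.D) : 0 ≤ (inner ℂ (ψ : H) (𝒞.Θ (mode 0) ψ : H)).re := by
  set G : circleFn := ⟨_, toCircle_one_mem⟩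
  set F : circleFn := (2 : ℂ) • mode 0 - G with hF
  have hFv : ∀ θ, F.1 θ = 1 - (Real.cos θ : ℂ) := by
    intro θ
    change (2 : ℂ) * (mode 0).1 θ - toCircle (fun _ => 1) θ = _
    rw [mode_zero_apply, toCircle]
    push_cast
    ring
  have hρ : IsCircleDiffeo fun θ => θ + Real.pi :=
    ⟨contDiff_id.add contDiff_const, fun θ => by simp, fun θ => by ring⟩
  obtain ⟨φ, hφ⟩ := 𝒞.exists_reparametrized hρ (F := F) (G := G) (fun θ => by
    rw [hFv]
    change toCircle (fun _ => 1) _ = _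
    simp [toCircle, Real.cos_add_pi]
    ring) ψ
  rw [anomaly_add_const] at hφ
  have h1 := 𝒞.spectrum_condition φ
  have h2 := 𝒞.spectrum_condition ψ
  rw [hφ] at h1
  simp only [Pi.zero_apply, Complex.ofReal_zero, mul_zero, intervalIntegral.integral_zero, zero_mul,
    add_zero, hF, map_sub, map_smul, LinearMap.sub_apply, LinearMap.smul_apply,
    Submodule.coe_sub, Submodule.coe_smul, inner_sub_right, inner_smul_right, Complex.sub_re] at h1
  have h3 : ((2 : ℂ) * inner ℂ (ψ : H) (𝒞.Θ (mode 0) ψ : H)).re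
      = 2 * (inner ℂ (ψ : H) (𝒞.Θ (mode 0) ψ : H)).re := by simp
  linarith

theorem deriv_mode (n : ℤ) (θ : ℝ) : deriv (mode n).1 θ = Complex.I * n * (mode n).1 θ := by
  have h1 : HasDerivAt (fun y : ℝ => Complex.I * n * (y : ℂ)) (Complex.I * n * 1) θ :=
    (Complex.ofRealCLM.hasDerivAt (x := θ)).const_mul _
  refine h1.cexp.deriv.trans ?_
  simp only [mode]
  ring

/-- By `[L₀, L_n] = -n L_n` the vector `L_n Ω` would have energy `-n`; for `n > 1` positivity of the
energy leaves only zero. -/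
theorem theta_mode_vacuum {n : ℤ} (hn : -1 ≤ n) : 𝒞.Θ (mode n) 𝒞.Ω = 0 := by
  rcases le_or_gt n 1 with h | h
  · exact 𝒞.vacuum n (abs_le.2 ⟨hn, h⟩)
  have hb : bracket (mode 0) (mode n) = -(Complex.I * n) • mode n := by
    ext θ
    change deriv (mode 0).1 θ * (mode n).1 θ - (mode 0).1 θ * deriv (mode n).1 θ
      = -(Complex.I * n) * (mode n).1 θ
    rw [deriv_mode, deriv_mode, mode_zero_apply]
    simp
  have h0 : (mode 0).1 = fun _ => 1 := funext mode_zero_apply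
  have h1 := 𝒞.commutator (mode 0) (mode n) 𝒞.Ω
  rw [𝒞.vacuum 0 (by simp), map_zero, sub_zero, hb, h0] at h1
  simp only [iteratedDeriv_const, deriv_const, map_smul, LinearMap.smul_apply, smul_smul] at h1
  have h2 := 𝒞.energy_nonneg (𝒞.Θ (mode n) 𝒞.Ω)
  rw [h1] at h2
  simp only [OfNat.ofNat_ne_zero, if_false, add_zero, mul_zero, intervalIntegral.integral_zero,
    zero_smul, Submodule.coe_smul, inner_smul_right] at h2
  have h3 : -Complex.I * -(Complex.I * n) = ((-n : ℝ) : ℂ) := by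
    push_cast
    linear_combination (n : ℂ) * Complex.I_sq
  rw [h3] at h2
  have h4 : (0 : ℝ) < n := by exact_mod_cast (by omega : 0 < n)
  have h5 : 0 ≤ -(n : ℝ) * ‖(𝒞.Θ (mode n) 𝒞.Ω : H)‖ ^ 2 := by
    rw [Complex.re_ofReal_mul] at h2
    exact h2.trans_eq (congrArg _ (inner_self_eq_norm_sq (𝕜 := ℂ) _))
  have h6 : ‖(𝒞.Θ (mode n) 𝒞.Ω : H)‖ ^ 2 ≤ 0 := by nlinarith
  have h7 : ‖(𝒞.Θ (mode n) 𝒞.Ω : H)‖ = 0 := by nlinarith [norm_nonneg (𝒞.Θ (mode n) 𝒞.Ω : H)]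
  exact Subtype.ext (norm_eq_zero.1 h7)

/-- The vacuum is annihilated by the fields smeared with positive frequency test functions. -/
theorem theta_vacuum_eq_zero {F : circleFn} (hF : ∀ n : ℤ, n < -1 → fourierSeq F.1 n = 0) :
    𝒞.Θ F 𝒞.Ω = 0 := by
  set a := fourierSeq F.1 with ha
  have hr : RapidDecay a := rapidDecay_fourierSeq F.2
  -- The distribution bound is taken against `Θ(F) Ω` itself. Finite Fourier sums of `F` annihilate
  -- `Ω`, so the squared norm of `Θ(F) Ω` is bounded by a tail of the series, which tends to zero.
  obtain ⟨N, C, hC⟩ := 𝒞.distribution (𝒞.Θ F 𝒞.Ω) 𝒞.Ω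
  set f : ℤ → ℝ := fun n => ∑ k ∈ Finset.range (N + 1), |(n : ℝ)| ^ k * ‖a n‖ with hf
  have hfs : Summable f := summable_sum fun k _ => hr k
  have hbound : ∀ s : Finset ℤ, ‖inner ℂ (𝒞.Θ F 𝒞.Ω : H) (𝒞.Θ F 𝒞.Ω : H)‖
      ≤ C * ∑' n : {n // n ∉ s}, f n := by
    intro s
    set S : circleFn := ∑ n ∈ s, a n • mode n with hS
    have hS0 : 𝒞.Θ S 𝒞.Ω = 0 := by
      rw [hS, map_sum, LinearMap.sum_apply]
      refine Finset.sum_eq_zero fun n _ => ?_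
      rw [map_smul, LinearMap.smul_apply]
      rcases lt_or_ge n (-1) with h | h
      · rw [hF n h, zero_smul]
      · rw [𝒞.theta_mode_vacuum h, smul_zero]
    have hr' : RapidDecay fun n => if n ∈ s then 0 else a n := hr.mono 1 fun n => by
      split_ifs <;> simp
    have hr'' : RapidDecay fun n => if n ∈ s then a n else 0 := hr.mono 1 fun n => by
      split_ifs <;> simp
    have hFS : (F - S).1 = modeSum fun n => if n ∈ s then 0 else a n := by
      have h1 : (fun n => if n ∈ s then 0 else a n) = fun n => a n - if n ∈ s then a n else 0 := by
        ext n; split_ifs <;> simp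
      ext θ
      rw [h1, hr.modeSum_sub hr'', ha, modeSum_fourierSeq F.2]
      change F.1 θ - S.1 θ = _
      congr 1
      rw [modeSum, tsum_eq_sum (s := s) fun n hn => by simp [hn], hS]
      simp only [Submodule.coe_sum, Finset.sum_apply]
      refine Finset.sum_congr rfl fun n hn => ?_
      simp [hn, mode, ha]
    have h1 := hC (F - S) (∑' n : {n // n ∉ s}, f n) fun k hk θ => by
      rw [hFS, hr'.iteratedDeriv_modeSum]
      refine ((hr'.freq_pow_mul k).norm_modeSum_le θ).trans ?_
      have h2 := tsum_subtype {n | n ∉ s} f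
      refine ((hr'.freq_pow_mul k).summable_norm.tsum_le_tsum (fun n => ?_)
        (hfs.indicator {n | n ∉ s})).trans_eq h2.symm
      by_cases hn : n ∈ s
      · simp [hn]
      · simp only [hn, if_false, Set.indicator, Set.mem_ofPred_eq, not_false_eq_true, if_true]
        rw [norm_mul, norm_pow, norm_mul, Complex.norm_I, one_mul, Complex.norm_intCast]
        exact Finset.single_le_sum (f := fun k => |(n : ℝ)| ^ k * ‖a n‖)
          (fun k _ => by positivity) (Finset.mem_range.2 (by omega))
    rwa [map_sub, LinearMap.sub_apply, hS0, sub_zero] at h1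
  have hlim := (tendsto_tsum_compl_atTop_zero f).const_mul C
  rw [mul_zero] at hlim
  have h0 := ge_of_tendsto' hlim hbound
  exact Subtype.ext (inner_self_eq_zero.1 (norm_le_zero_iff.1 h0))

variable {τ : ℝ} (hτ : 0 < τ)

theorem theta_posField_vacuum : 𝒞.Θ (posField hτ) 𝒞.Ω = 0 :=
  𝒞.theta_vacuum_eq_zero fun _ hn => fourierSeq_posField hτ hn

/-- Conjugation reverses frequencies, so the adjoint field is smeared with modes `≥ -1` and
annihilates the vacuum. -/
theorem inner_vacuum_theta_negField (ψ : 𝒞.D) :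
    inner ℂ (𝒞.Ω : H) (𝒞.Θ (gaussField hτ - posField hτ) ψ : H) = 0 := by
  rw [𝒞.hermitian, 𝒞.theta_vacuum_eq_zero fun n hn => ?_, Submodule.coe_zero, inner_zero_left]
  rw [fourierSeq_conjFn, fourierSeq_negField hτ (by omega), map_zero]

theorem theta_posField_comm (ψ : 𝒞.D) :
    𝒞.Θ (posField hτ) (𝒞.T (gaussianFn hτ) ψ) = 𝒞.T (gaussianFn hτ) (𝒞.Θ (posField hτ) ψ)
      + ((1 / (Real.pi * τ ^ 2) : ℝ) : ℂ) • 𝒞.T (gaussianFn hτ) ψ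
      + ((c / 24 / (Real.pi * τ ^ 2) ^ 2 : ℝ) : ℂ) • ψ := by
  have h := 𝒞.commutator (posField hτ) (gaussField hτ) ψ
  rw [bracket_posField, central_integral, map_smul, LinearMap.smul_apply, smul_smul,
    sub_eq_iff_eq_add] at h
  change 𝒞.Θ (posField hτ) (𝒞.Θ (gaussField hτ) ψ) = 𝒞.Θ (gaussField hτ) (𝒞.Θ (posField hτ) ψ)
    + _ • 𝒞.Θ (gaussField hτ) ψ + _
  have h1 : -Complex.I * (Complex.I / (Real.pi * τ ^ 2)) = ((1 / (Real.pi * τ ^ 2) : ℝ) : ℂ) := by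
    push_cast
    linear_combination -(1 / (Real.pi * τ ^ 2) : ℂ) * Complex.I_sq
  have h2 : Complex.I * ((c / (24 * Real.pi) : ℝ) : ℂ) * -(Complex.I / (Real.pi * τ ^ 4))
      = ((c / 24 / (Real.pi * τ ^ 2) ^ 2 : ℝ) : ℂ) := by
    have : (τ : ℂ) ≠ 0 := by exact_mod_cast hτ.ne'
    have hπ : (Real.pi : ℂ) ≠ 0 := by exact_mod_cast Real.pi_ne_zero
    push_cast
    field_simp
    linear_combination -(c : ℂ) * Complex.I_sq
  rw [h, h1, h2]
  abel

theorem T_pow_succ_apply (f : LineFn) (n : ℕ) (ψ : 𝒞.D) :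
    (𝒞.T f ^ (n + 1)) ψ = 𝒞.T f ((𝒞.T f ^ n) ψ) := by
  rw [pow_succ', Module.End.mul_apply]

/-- The commutator of `Θ(f₊)` with `T(f)` is a polynomial in `T(f)`, hence commutes with `T(f)`; the
`n + 1` factors contribute equally, and what is left annihilates the vacuum. -/
theorem theta_posField_pow (n : ℕ) :
    𝒞.Θ (posField hτ) ((𝒞.T (gaussianFn hτ) ^ (n + 1)) 𝒞.Ω) = (n + 1 : ℂ) •
      (((1 / (Real.pi * τ ^ 2) : ℝ) : ℂ) • (𝒞.T (gaussianFn hτ) ^ (n + 1)) 𝒞.Ω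
        + ((c / 24 / (Real.pi * τ ^ 2) ^ 2 : ℝ) : ℂ) • (𝒞.T (gaussianFn hτ) ^ n) 𝒞.Ω) := by
  induction n with
  | zero =>
    simp only [zero_add, pow_one, pow_zero, Module.End.one_apply, theta_posField_comm,
      theta_posField_vacuum, map_zero, Nat.cast_zero, one_smul]
  | succ n ih =>
    rw [T_pow_succ_apply, theta_posField_comm, ih, map_smul, map_add, map_smul, map_smul,
      ← T_pow_succ_apply, ← T_pow_succ_apply]
    push_cast
    module

theorem moment_zero (f : LineFn) : 𝒞.moment f 0 = 1 := by
  simp [moment, inner_self_eq_norm_sq_to_K, 𝒞.norm_Ω]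

theorem moment_succ (n : ℕ) : 𝒞.moment (gaussianFn hτ) (n + 1) =
    inner ℂ (𝒞.Ω : H) (𝒞.Θ (posField hτ) ((𝒞.T (gaussianFn hτ) ^ n) 𝒞.Ω) : H) := by
  have h := 𝒞.inner_vacuum_theta_negField hτ ((𝒞.T (gaussianFn hτ) ^ n) 𝒞.Ω)
  rw [map_sub, LinearMap.sub_apply, Submodule.coe_sub, inner_sub_right, sub_eq_zero] at h
  rw [← h, moment, T_pow_succ_apply]
  rfl

theorem moment_one : 𝒞.moment (gaussianFn hτ) 1 = 0 := by
  have h := 𝒞.moment_succ hτ 0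
  simpa [theta_posField_vacuum] using h

theorem moment_add_two (n : ℕ) : 𝒞.moment (gaussianFn hτ) (n + 2) = (n + 1) *
    (((1 / (Real.pi * τ ^ 2) : ℝ) : ℂ) * 𝒞.moment (gaussianFn hτ) (n + 1)
      + ((c / 24 / (Real.pi * τ ^ 2) ^ 2 : ℝ) : ℂ) * 𝒞.moment (gaussianFn hτ) n) := by
  rw [moment_succ, theta_posField_pow]
  simp only [Submodule.coe_smul, Submodule.coe_add, inner_smul_right, inner_add_right, moment]

end ChiralCFT

/-! ### The quantum energy inequality -/

section EnergyInequality

open scoped ContDiff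

/-- The angle reparametrization that turns the positive vector field `g(θ) ∂_θ` into a multiple
of the rotation generator. -/
def straighten (g : ℝ → ℝ) (θ : ℝ) : ℝ :=
  2 * Real.pi / (∫ x in (0 : ℝ)..(2 * Real.pi), (g x)⁻¹) * ∫ x in (0 : ℝ)..θ, (g x)⁻¹

/-- The angular velocity of the straightened vector field. -/
def angularVelocity (g : ℝ → ℝ) : ℝ := 2 * Real.pi / ∫ x in (0 : ℝ)..(2 * Real.pi), (g x)⁻¹

variable {g : ℝ → ℝ}

theorem integral_inv_pos (hg : ContDiff ℝ ∞ g) (hpos : ∀ θ, 0 < g θ) :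
    0 < ∫ x in (0 : ℝ)..(2 * Real.pi), (g x)⁻¹ :=
  intervalIntegral.intervalIntegral_pos_of_pos
    ((hg.continuous.inv₀ fun θ => (hpos θ).ne').intervalIntegrable _ _)
    (fun θ => inv_pos.2 (hpos θ)) Real.two_pi_pos

theorem angularVelocity_pos (hg : ContDiff ℝ ∞ g) (hpos : ∀ θ, 0 < g θ) :
    0 < angularVelocity g :=
  div_pos Real.two_pi_pos (integral_inv_pos hg hpos)

theorem deriv_straighten (hg : ContDiff ℝ ∞ g) (hpos : ∀ θ, 0 < g θ) :
    deriv (straighten g) = fun θ => angularVelocity g / g θ := by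
  have hc : Continuous fun θ => (g θ)⁻¹ := hg.continuous.inv₀ fun θ => (hpos θ).ne'
  ext θ
  exact ((intervalIntegral.integral_hasDerivAt_right (hc.intervalIntegrable _ _)
    (hc.stronglyMeasurableAtFilter _ _) hc.continuousAt).const_mul _).deriv

theorem isCircleDiffeo_straighten (hg : ContDiff ℝ ∞ g) (hpos : ∀ θ, 0 < g θ)
    (hper : Function.Periodic g (2 * Real.pi)) : IsCircleDiffeo (straighten g) := by
  have hc : Continuous fun θ => (g θ)⁻¹ := hg.continuous.inv₀ fun θ => (hpos θ).ne'
  have hd := deriv_straighten hg hpos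
  refine ⟨contDiff_infty_iff_deriv.2 ⟨fun θ => ?_, ?_⟩, fun θ => ?_, fun θ => ?_⟩
  · exact ((intervalIntegral.integral_hasDerivAt_right (hc.intervalIntegrable _ _)
      (hc.stronglyMeasurableAtFilter _ _) hc.continuousAt).const_mul _).differentiableAt
  · rw [hd]
    exact contDiff_const.div hg fun θ => (hpos θ).ne'
  · rw [hd]
    exact div_pos (angularVelocity_pos hg hpos) (hpos θ)
  · have hp : Function.Periodic (fun θ => (g θ)⁻¹) (2 * Real.pi) := fun x => by simp only [hper x]
    have h := hp.intervalIntegral_add_eq θ 0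
    rw [zero_add] at h
    rw [straighten, straighten, ← intervalIntegral.integral_add_adjacent_intervals
      (hc.intervalIntegrable 0 θ) (hc.intervalIntegrable θ (θ + 2 * Real.pi)), h, mul_add,
      div_mul_cancel₀ _ (integral_inv_pos hg hpos).ne']

/-- Here `ρ' = l/g`, so `1/√ρ' = √(g/l)`. In the Schwarzian derivative `l` cancels, and it survives
only in `ρ'²/2`. -/
theorem mul_anomaly_straighten (hg : ContDiff ℝ ∞ g) (hpos : ∀ θ, 0 < g θ) (θ : ℝ) :
    g θ * anomaly (straighten g) θ = -deriv (deriv g) θ + deriv g θ ^ 2 / (2 * g θ)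
      + (angularVelocity g ^ 2 * (g θ)⁻¹ - g θ) / 2 := by
  set l := angularVelocity g with hl
  have hl0 : 0 < l := angularVelocity_pos hg hpos
  have hd1 : ∀ x, HasDerivAt g (deriv g x) x := fun x =>
    (hg.differentiable (by simp) x).hasDerivAt
  have hd2 : ∀ x, HasDerivAt (deriv g) (deriv (deriv g) x) x := fun x =>
    ((contDiff_infty_iff_deriv.1 hg).2.differentiable (by simp) x).hasDerivAt
  have hs : ∀ x, 0 < √(g x) := fun x => Real.sqrt_pos.2 (hpos x)
  have h1 : (fun w => 1 / √(l / g w)) = fun w => (√l)⁻¹ * √(g w) := by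
    ext w
    rw [Real.sqrt_div hl0.le]
    field_simp
  have h2 : ∀ x, HasDerivAt (fun w => (√l)⁻¹ * √(g w)) ((√l)⁻¹ * (deriv g x / (2 * √(g x)))) x :=
    fun x => ((hd1 x).sqrt (hpos x).ne').const_mul _
  have h3 : HasDerivAt (fun x => (√l)⁻¹ * (deriv g x / (2 * √(g x)))) _ θ :=
    ((hd2 θ).div (((hd1 θ).sqrt (hpos θ).ne').const_mul 2)
      (mul_pos two_pos (hs θ)).ne').const_mul _
  rw [anomaly, schwarzian, deriv_straighten hg hpos, ← hl, h1, iteratedDeriv_succ,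
    iteratedDeriv_one, funext fun x => (h2 x).deriv, h3.deriv, Real.sqrt_div hl0.le]
  have hl' := Real.sqrt_pos.2 hl0
  have hθ := hs θ
  have hgθ := hpos θ
  have hsq : √(g θ) ^ 2 = g θ := Real.sq_sqrt hgθ.le
  generalize √(g θ) = r at *
  beta_reduce
  rw [← hsq]
  field_simp
  ring

/-- The term `-g''` integrates to zero over a period, and `∫ 1/g = 2π/l` turns `(l²/2) ∫ 1/g` into
`π l`. -/
theorem integral_mul_anomaly_straighten (hg : ContDiff ℝ ∞ g) (hpos : ∀ θ, 0 < g θ)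
    (hper : Function.Periodic g (2 * Real.pi)) :
    ∫ θ in (0 : ℝ)..(2 * Real.pi), g θ * anomaly (straighten g) θ
      = (∫ θ in (0 : ℝ)..(2 * Real.pi), (deriv g θ ^ 2 / (2 * g θ) - g θ / 2))
        + Real.pi * angularVelocity g := by
  have hc : Continuous fun θ => (g θ)⁻¹ := hg.continuous.inv₀ fun θ => (hpos θ).ne'
  have hg1 := (contDiff_infty_iff_deriv.1 hg).2
  have hg2 := (contDiff_infty_iff_deriv.1 hg1).2
  have hper1 : deriv g (2 * Real.pi) = deriv g 0 := by
    have : Function.Periodic (deriv g) (2 * Real.pi) := fun θ => by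
      rw [← deriv_comp_add_const]
      congr 1
      exact funext hper
    simpa using this 0
  have hcq : Continuous fun θ => deriv g θ ^ 2 / (2 * g θ) - g θ / 2 :=
    ((hg1.continuous.pow 2).div (continuous_const.mul hg.continuous)
      fun θ => (mul_pos two_pos (hpos θ)).ne').sub (hg.continuous.div_const 2)
  have he : ∀ θ, g θ * anomaly (straighten g) θ = (deriv g θ ^ 2 / (2 * g θ) - g θ / 2)
      + (angularVelocity g ^ 2 / 2 * (g θ)⁻¹ - deriv (deriv g) θ) := fun θ => by
    rw [mul_anomaly_straighten hg hpos]; ring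
  simp_rw [he]
  rw [intervalIntegral.integral_add (hcq.intervalIntegrable _ _)
    (((hc.intervalIntegrable _ _).const_mul _).sub (hg2.continuous.intervalIntegrable _ _)),
    intervalIntegral.integral_sub ((hc.intervalIntegrable _ _).const_mul _)
      (hg2.continuous.intervalIntegrable _ _), intervalIntegral.integral_const_mul,
    intervalIntegral.integral_deriv_eq_sub (fun x _ => hg1.differentiable (by simp) x)
      (hg2.continuous.intervalIntegrable _ _), hper1, sub_self, sub_zero]
  congr 1
  have := (integral_inv_pos hg hpos).ne'
  rw [angularVelocity]
  field_simp

/-- A lower bound for fields smeared with a strictly positive vector field. -/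
theorem ChiralCFT.energy_inequality_of_pos {H : Type*} [NormedAddCommGroup H]
    [InnerProductSpace ℂ H] {c : ℝ} (𝒞 : ChiralCFT H c) (hg : ContDiff ℝ ∞ g)
    (hpos : ∀ θ, 0 < g θ) (hper : Function.Periodic g (2 * Real.pi)) (ψ : 𝒞.D) :
    -(c / (24 * Real.pi) * ((∫ θ in (0 : ℝ)..(2 * Real.pi), (deriv g θ ^ 2 / (2 * g θ) - g θ / 2))
        + Real.pi * angularVelocity g)) * ‖(ψ : H)‖ ^ 2
      ≤ (inner ℂ (ψ : H) (𝒞.Θ ⟨_, ofReal_mem hg hper⟩ ψ : H)).re := by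
  -- Straightening pushes `g ∂_θ` forward to the constant field, that is, to a positive multiple of
  -- `L₀`; only the anomaly can be negative.
  obtain ⟨φ, hφ⟩ := 𝒞.exists_reparametrized (isCircleDiffeo_straighten hg hpos hper)
    (F := ⟨_, ofReal_mem hg hper⟩) (G := (angularVelocity g : ℂ) • mode 0) (fun θ => by
      change (angularVelocity g : ℂ) * (mode 0).1 _ = _ * (g θ : ℂ)
      rw [ChiralCFT.mode_zero_apply, deriv_straighten hg hpos, mul_one]
      norm_cast
      rw [div_mul_cancel₀ _ (hpos θ).ne']) ψ
  have h1 := 𝒞.energy_nonneg φ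
  have h2 : ∫ θ in (0 : ℝ)..(2 * Real.pi), (g θ : ℂ) * (anomaly (straighten g) θ : ℂ)
      = ((∫ θ in (0 : ℝ)..(2 * Real.pi), g θ * anomaly (straighten g) θ : ℝ) : ℂ) := by
    rw [← intervalIntegral.integral_ofReal]
    simp
  simp only [h2, integral_mul_anomaly_straighten hg hpos hper] at hφ
  have h3 := congrArg Complex.re hφ
  rw [map_smul, LinearMap.smul_apply, Submodule.coe_smul, inner_smul_right, Complex.re_ofReal_mul,
    ← Complex.ofReal_mul, ← Complex.ofReal_mul, Complex.add_re, Complex.ofReal_re] at h3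
  have h4 := mul_nonneg (angularVelocity_pos hg hpos).le h1
  linarith

variable {τ : ℝ}

/-- The real Gaussian vector field on the circle. -/
def gaussReal (τ θ : ℝ) : ℝ := (1 + Real.cos θ) ^ 2 * flat τ 1 θ

theorem gaussReal_contDiff (hτ : 0 < τ) : ContDiff ℝ ∞ (gaussReal τ) :=
  ((contDiff_const.add Real.contDiff_cos).pow 2).mul (flat_contDiff hτ one_ne_zero)

theorem gaussReal_periodic : Function.Periodic (gaussReal τ) (2 * Real.pi) := fun θ => by
  rw [gaussReal, flat_periodic, Real.cos_add_two_pi, gaussReal]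

theorem flat_nonneg (hτ : 0 < τ) (m : ℕ) (θ : ℝ) : 0 ≤ flat τ m θ :=
  div_nonneg (gaussian_pos hτ _).le (pow_nonneg (by linarith [Real.neg_one_le_cos θ]) _)

theorem gaussReal_nonneg (hτ : 0 < τ) (θ : ℝ) : 0 ≤ gaussReal τ θ :=
  mul_nonneg (sq_nonneg _) (flat_nonneg hτ 1 θ)

theorem deriv_gaussReal {θ : ℝ} (h : Real.cos (θ / 2) ≠ 0) :
    deriv (gaussReal τ) θ = -(Real.sin θ * (1 + Real.cos θ + 2 / τ ^ 2) * flat τ 1 θ) := by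
  have h1 := (((Real.hasDerivAt_cos θ).const_add 1).pow 2).mul (hasDerivAt_flat (τ := τ) 1 h)
  refine h1.deriv.trans ?_
  have := one_add_cos_ne_zero h
  simp only [Pi.pow_apply, Nat.add_one_sub_one, Nat.cast_ofNat, pow_one, sin_eq_tan_half_mul h]
  field_simp
  push_cast
  ring

/-- The density `F'² / (2 F)` of the energy bound for the Gaussian vector field `F`. -/
def boundDensity (τ θ : ℝ) : ℝ :=
  (1 - Real.cos θ) * (1 + Real.cos θ + 2 / τ ^ 2) ^ 2 * flat τ 2 θ / 2

theorem boundDensity_continuous (hτ : 0 < τ) : Continuous (boundDensity τ) := by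
  have := (flat_contDiff hτ two_ne_zero).continuous
  unfold boundDensity
  fun_prop

theorem sq_deriv_gaussReal_eq {θ : ℝ} (h : Real.cos (θ / 2) ≠ 0) :
    deriv (gaussReal τ) θ ^ 2 = 2 * gaussReal τ θ * boundDensity τ θ := by
  rw [deriv_gaussReal h, gaussReal, boundDensity, flat, flat]
  have h1 := one_add_cos_ne_zero h
  have h2 := Real.sin_sq θ
  field_simp
  rw [h2]
  ring

/-- Off `θ = π` the integrand is the derivative of a periodic function `E` plus `flat/τ²`, and
`flat` has unit mass. -/
theorem integral_boundDensity (hτ : 0 < τ) :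
    ∫ θ in (0 : ℝ)..(2 * Real.pi), (boundDensity τ θ - gaussReal τ θ / 2) = 1 / τ ^ 2 := by
  set E : ℝ → ℝ := fun θ => -(Real.sin θ * (1 + Real.cos θ + 1 / τ ^ 2)) * flat τ 1 θ with hE
  have hEc : ContDiff ℝ ∞ E := (Real.contDiff_sin.mul ((contDiff_const.add
    Real.contDiff_cos).add contDiff_const)).neg.mul (flat_contDiff hτ one_ne_zero)
  have hEc1 := (contDiff_infty_iff_deriv.1 hEc).2.continuous
  have hEp : E (2 * Real.pi) = E 0 := by simp [hE]
  have h : ∫ θ in (0 : ℝ)..(2 * Real.pi), (boundDensity τ θ - gaussReal τ θ / 2)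
      = ∫ θ in (0 : ℝ)..(2 * Real.pi), (deriv E θ + 1 / τ ^ 2 * flat τ 1 θ) := by
    refine intervalIntegral.integral_congr_ae ?_
    filter_upwards [ae_cos_half_ne_zero] with θ hθ _
    have h1 := ((Real.hasDerivAt_sin θ).mul
      (((Real.hasDerivAt_cos θ).const_add 1).add_const (1 / τ ^ 2))).neg.mul
      (hasDerivAt_flat (τ := τ) 1 hθ)
    rw [(show HasDerivAt E _ θ from h1).deriv, boundDensity, gaussReal]
    have h0 := one_add_cos_ne_zero hθ
    have h2 : flat τ 2 θ = flat τ 1 θ * (1 + Real.cos θ)⁻¹ := by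
      rw [flat, flat]; field_simp
    have h3 : Real.cos θ = 2 / (1 + Real.tan (θ / 2) ^ 2) - 1 := by
      have := inv_one_add_cos hθ
      rw [inv_eq_iff_eq_inv] at this
      rw [eq_sub_iff_add_eq, add_comm, this, inv_div]
    have h4 : (0 : ℝ) < 1 + Real.tan (θ / 2) ^ 2 := by positivity
    simp only [Pi.mul_apply, Pi.neg_apply]
    rw [h2, inv_one_add_cos hθ, sin_eq_tan_half_mul hθ, h3]
    field_simp
    push_cast
    ring
  rw [h, intervalIntegral.integral_add (hEc1.intervalIntegrable _ _)
    (((flat_contDiff hτ one_ne_zero).continuous.intervalIntegrable _ _).const_mul _),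
    intervalIntegral.integral_deriv_eq_sub (fun x _ => hEc.differentiable (by simp) x)
      (hEc1.intervalIntegrable _ _), hEp, sub_self, zero_add, intervalIntegral.integral_const_mul,
    integral_flat_one hτ, mul_one]

theorem flat_bounded (hτ : 0 < τ) : ∃ B, 0 < B ∧ ∀ θ ∈ Set.Icc 0 (2 * Real.pi), flat τ 1 θ ≤ B := by
  obtain ⟨B, hB⟩ := (isCompact_Icc (a := (0 : ℝ)) (b := 2 * Real.pi)).exists_bound_of_continuousOn
    (flat_contDiff hτ one_ne_zero).continuous.continuousOn
  exact ⟨max B 1, by positivity, fun θ hθ => (le_abs_self _).trans ((hB θ hθ).trans (le_max_left _ _))⟩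

/-- The Gaussian field vanishes at `θ = π`. On `|θ - π| ≤ δ` the regularised field is at most `(B +
1) δ²`, so the time `∫ 1/g` of one revolution is at least `2/((B + 1) δ)`. -/
theorem angularVelocity_le (hτ : 0 < τ) : ∃ K, ∀ δ : ℝ, 0 < δ → δ ≤ 1 →
    angularVelocity (fun θ => gaussReal τ θ + δ ^ 2) ≤ K * δ := by
  obtain ⟨B, hB0, hB⟩ := flat_bounded hτ
  refine ⟨Real.pi * (B + 1), fun δ hδ hδ1 => ?_⟩
  have hpi := Real.pi_gt_three
  have hpos : ∀ θ, 0 < gaussReal τ θ + δ ^ 2 := fun θ =>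
    add_pos_of_nonneg_of_pos (gaussReal_nonneg hτ θ) (by positivity)
  have hcont : Continuous fun θ => (gaussReal τ θ + δ ^ 2)⁻¹ :=
    ((gaussReal_contDiff hτ).continuous.add continuous_const).inv₀ fun θ => (hpos θ).ne'
  have h1 : ∫ _ in (Real.pi - δ)..(Real.pi + δ), ((B + 1) * δ ^ 2)⁻¹
      ≤ ∫ θ in (Real.pi - δ)..(Real.pi + δ), (gaussReal τ θ + δ ^ 2)⁻¹ := by
    refine intervalIntegral.integral_mono_on (by linarith) (by simp)
      (hcont.intervalIntegrable _ _) fun θ hθ => ?_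
    refine inv_anti₀ (hpos θ) ?_
    have hsq : (θ - Real.pi) ^ 2 ≤ δ ^ 2 := by
      refine sq_le_sq' ?_ ?_ <;> linarith [hθ.1, hθ.2]
    have hcos : 1 + Real.cos θ ≤ δ ^ 2 / 2 := by
      have := Real.one_sub_sq_div_two_le_cos (x := θ - Real.pi)
      rw [Real.cos_sub_pi] at this
      linarith
    have hcos0 : 0 ≤ 1 + Real.cos θ := by linarith [Real.neg_one_le_cos θ]
    -- The crude bound `(1 + cos θ)² ≤ 2 (1 + cos θ)` suffices.
    have hcos2 : (1 + Real.cos θ) ^ 2 ≤ δ ^ 2 := by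
      nlinarith [Real.cos_le_one θ]
    have := mul_le_mul hcos2 (hB θ ⟨by linarith [hθ.1], by linarith [hθ.2]⟩)
      (flat_nonneg hτ 1 θ) (sq_nonneg δ)
    rw [gaussReal]
    linarith
  have h2 : ∫ θ in (Real.pi - δ)..(Real.pi + δ), (gaussReal τ θ + δ ^ 2)⁻¹
      ≤ ∫ θ in (0 : ℝ)..(2 * Real.pi), (gaussReal τ θ + δ ^ 2)⁻¹ :=
    intervalIntegral.integral_mono_interval (by linarith) (by linarith) (by linarith)
      (Filter.Eventually.of_forall fun θ => (inv_pos.2 (hpos θ)).le) (hcont.intervalIntegrable _ _)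
  rw [intervalIntegral.integral_const, smul_eq_mul] at h1
  have h3 : 2 / ((B + 1) * δ) ≤ ∫ θ in (0 : ℝ)..(2 * Real.pi), (gaussReal τ θ + δ ^ 2)⁻¹ := by
    refine le_trans (le_of_eq ?_) (h1.trans h2)
    field_simp
    ring
  rw [angularVelocity]
  calc 2 * Real.pi / _ ≤ 2 * Real.pi / (2 / ((B + 1) * δ)) := by gcongr
    _ = _ := by field_simp

/-- The quantum energy inequality for the Gaussian. -/
theorem ChiralCFT.energy_inequality {H : Type*} [NormedAddCommGroup H]
    [InnerProductSpace ℂ H] {c : ℝ} (hc : 0 < c) (𝒞 : ChiralCFT H c) (hτ : 0 < τ) (ψ : 𝒞.D) :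
    -(c / (24 * Real.pi * τ ^ 2)) * ‖(ψ : H)‖ ^ 2
      ≤ (inner ℂ (ψ : H) (𝒞.T (gaussianFn hτ) ψ : H)).re := by
  obtain ⟨K, hK⟩ := angularVelocity_le hτ
  set x := (inner ℂ (ψ : H) (𝒞.T (gaussianFn hτ) ψ : H)).re
  set y := (inner ℂ (ψ : H) (𝒞.Θ (mode 0) ψ : H)).re
  -- Adding `δ²` makes the vector field strictly positive. The price is `δ² L₀` and an angular
  -- velocity of order `δ`, both of which disappear in the limit.
  have key : ∀ δ : ℝ, 0 < δ → δ ≤ 1 →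
      -(c / (24 * Real.pi) * (1 / τ ^ 2 + Real.pi * (K * δ))) * ‖(ψ : H)‖ ^ 2 ≤ x + δ ^ 2 * y := by
    intro δ hδ hδ1
    set g : ℝ → ℝ := fun θ => gaussReal τ θ + δ ^ 2 with hg
    have hpos : ∀ θ, 0 < g θ := fun θ =>
      add_pos_of_nonneg_of_pos (gaussReal_nonneg hτ θ) (by positivity)
    have hsm : ContDiff ℝ ∞ g := (gaussReal_contDiff hτ).add contDiff_const
    have hper : Function.Periodic g (2 * Real.pi) := fun θ => by
      simp only [hg, gaussReal_periodic θ]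
    have hd : deriv g = deriv (gaussReal τ) := by
      ext θ; simp [hg]
    have h1 := 𝒞.energy_inequality_of_pos hsm hpos hper ψ
    have h2 : (⟨_, ofReal_mem hsm hper⟩ : circleFn)
        = gaussField hτ + ((δ ^ 2 : ℝ) : ℂ) • mode 0 := by
      ext θ
      change ((gaussReal τ θ + δ ^ 2 : ℝ) : ℂ) = (gaussField hτ).1 θ + _ * (mode 0).1 θ
      rw [mode_zero_apply, gaussField_apply, gaussReal]
      push_cast
      ring
    rw [h2, map_add, map_smul, LinearMap.add_apply, LinearMap.smul_apply, Submodule.coe_add,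
      Submodule.coe_smul, inner_add_right, inner_smul_right, Complex.add_re,
      Complex.re_ofReal_mul] at h1
    refine le_trans ?_ h1
    have h3 : ∫ θ in (0 : ℝ)..(2 * Real.pi), (deriv g θ ^ 2 / (2 * g θ) - g θ / 2)
        ≤ ∫ θ in (0 : ℝ)..(2 * Real.pi), (boundDensity τ θ - gaussReal τ θ / 2) := by
      have hcq : Continuous fun θ => deriv g θ ^ 2 / (2 * g θ) - g θ / 2 :=
        (((contDiff_infty_iff_deriv.1 hsm).2.continuous.pow 2).div
          (continuous_const.mul hsm.continuous)
          fun θ => (mul_pos two_pos (hpos θ)).ne').sub (hsm.continuous.div_const 2)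
      refine intervalIntegral.integral_mono_ae Real.two_pi_pos.le (hcq.intervalIntegrable _ _)
        (((boundDensity_continuous hτ).sub
          ((gaussReal_contDiff hτ).continuous.div_const 2)).intervalIntegrable _ _) ?_
      filter_upwards [ae_cos_half_ne_zero] with θ hθ
      -- The derivative does not see `δ²`, while the denominator grows, so the quotient only
      -- decreases.
      have h5 : deriv g θ ^ 2 / (2 * g θ) ≤ boundDensity τ θ := by
        rw [div_le_iff₀ (mul_pos two_pos (hpos θ)), hd, sq_deriv_gaussReal_eq hθ]
        have h6 : 0 ≤ boundDensity τ θ := by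
          have := Real.cos_le_one θ
          have := flat_nonneg hτ 2 θ
          rw [boundDensity]
          have : 0 ≤ 1 - Real.cos θ := by linarith
          positivity
        simp only [hg]
        nlinarith [mul_nonneg h6 (sq_nonneg δ)]
      simp only [hg] at h5 ⊢
      linarith [sq_nonneg δ]
    rw [integral_boundDensity hτ] at h3
    have h4 := hK δ hδ hδ1
    rw [neg_mul, neg_mul, neg_le_neg_iff]
    gcongr
  have hlim : Filter.Tendsto (fun δ : ℝ => x + δ ^ 2 * y
      + c / (24 * Real.pi) * (1 / τ ^ 2 + Real.pi * (K * δ)) * ‖(ψ : H)‖ ^ 2)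
      (nhdsWithin 0 (Set.Ioi 0)) (nhds (x + 0 ^ 2 * y
      + c / (24 * Real.pi) * (1 / τ ^ 2 + Real.pi * (K * 0)) * ‖(ψ : H)‖ ^ 2)) :=
    ((by fun_prop : Continuous fun δ : ℝ => x + δ ^ 2 * y
      + c / (24 * Real.pi) * (1 / τ ^ 2 + Real.pi * (K * δ)) * ‖(ψ : H)‖ ^ 2).tendsto 0).mono_left
      nhdsWithin_le_nhds
  have h0 : (0 : ℝ) ≤ x + 0 ^ 2 * y
      + c / (24 * Real.pi) * (1 / τ ^ 2 + Real.pi * (K * 0)) * ‖(ψ : H)‖ ^ 2 := by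
    refine ge_of_tendsto hlim ?_
    filter_upwards [Ioc_mem_nhdsGT (zero_lt_one' ℝ)] with δ hδ
    linarith [key δ hδ.1 hδ.2]
  have he : c / (24 * Real.pi * τ ^ 2) = c / (24 * Real.pi) * (1 / τ ^ 2) := by
    field_simp
  rw [he]
  linarith

end EnergyInequality

/-! ### Moments and support of the shifted Gamma law -/

section ShiftedGamma

variable {ω₀ α β : ℝ}

theorem integral_shiftedGamma (hα : 0 < α) (hβ : 0 < β) (h : ℝ → ℝ) :
    ∫ ω, h ω ∂shiftedGamma ω₀ α β = ∫ x in Set.Ioi (0 : ℝ),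
      β ^ α / Real.Gamma α * x ^ (α - 1) * Real.exp (-(β * x)) * h (x - ω₀) := by
  have hm : Measurable fun ω => gammaPDF α β (ω + ω₀) :=
    ((measurable_gammaPDFReal α β).comp (measurable_add_const ω₀)).ennreal_ofReal
  rw [shiftedGamma, integral_withDensity_eq_integral_toReal_smul hm
    (Filter.Eventually.of_forall fun _ => ENNReal.ofReal_lt_top)]
  have h1 := integral_add_right_eq_self (μ := volume)
    (fun x => (gammaPDF α β x).toReal • h (x - ω₀)) ω₀
  simp only [add_sub_cancel_right] at h1
  rw [h1, ← integral_Ici_eq_integral_Ioi, ← integral_indicator measurableSet_Ici]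
  congr 1
  ext x
  by_cases hx : 0 ≤ x
  · rw [Set.indicator_of_mem (Set.mem_Ici.2 hx), gammaPDF, ENNReal.toReal_ofReal
      (gammaPDFReal_nonneg hα hβ x), gammaPDFReal, if_pos hx, smul_eq_mul]
  · rw [Set.indicator_of_notMem (by simpa using hx), gammaPDF_of_neg (not_le.1 hx)]
    simp

theorem integral_pow_mul_exp_shiftedGamma (hα : 0 < α) (hβ : 0 < β) (m : ℕ) {t : ℝ} (ht : t < β) :
    ∫ ω, (ω + ω₀) ^ m * Real.exp (t * (ω + ω₀)) ∂shiftedGamma ω₀ α β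
      = β ^ α / Real.Gamma α * ((1 / (β - t)) ^ (α + m) * Real.Gamma (α + m)) := by
  rw [integral_shiftedGamma hα hβ, ← Real.integral_rpow_mul_exp_neg_mul_Ioi (by positivity)
    (sub_pos.2 ht), ← integral_const_mul]
  refine setIntegral_congr_fun measurableSet_Ioi fun x (hx : 0 < x) => ?_
  simp only [sub_add_cancel]
  rw [show α + m - 1 = (α - 1) + m by ring, Real.rpow_add hx, Real.rpow_natCast,
    show -((β - t) * x) = -(β * x) + t * x by ring, Real.exp_add]
  ring

theorem integrable_pow_mul_exp_shiftedGamma (hα : 0 < α) (hβ : 0 < β) (m : ℕ) {t : ℝ}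
    (ht : t < β) :
    Integrable (fun ω => (ω + ω₀) ^ m * Real.exp (t * (ω + ω₀))) (shiftedGamma ω₀ α β) := by
  -- A nonintegrable function has integral `0` by convention, so it suffices that the computed value
  -- is nonzero.
  refine not_imp_comm.1 integral_undef ?_
  rw [integral_pow_mul_exp_shiftedGamma hα hβ m ht]
  have := Real.Gamma_pos_of_pos hα
  have := Real.Gamma_pos_of_pos (show 0 < α + m by positivity)
  have := sub_pos.2 ht
  positivity

theorem isProbabilityMeasure_shiftedGamma (hα : 0 < α) (hβ : 0 < β) :
    IsProbabilityMeasure (shiftedGamma ω₀ α β) where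
  measure_univ := by
    rw [shiftedGamma, withDensity_apply _ MeasurableSet.univ, Measure.restrict_univ,
      lintegral_add_right_eq_self (gammaPDF α β) ω₀, lintegral_gammaPDF_eq_one hα hβ]

theorem integrable_exp_shiftedGamma (hα : 0 < α) (hβ : 0 < β) {t : ℝ} (ht : t < β) :
    Integrable (fun ω => Real.exp (t * ω)) (shiftedGamma ω₀ α β) := by
  refine ((integrable_pow_mul_exp_shiftedGamma (ω₀ := ω₀) hα hβ 0 ht).const_mul
    (Real.exp (-(t * ω₀)))).congr (Filter.Eventually.of_forall fun ω => ?_)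
  simp only [pow_zero, one_mul]
  rw [← Real.exp_add]
  ring_nf

theorem integral_exp_shiftedGamma (hα : 0 < α) (hβ : 0 < β) {t : ℝ} (ht : t < β) :
    ∫ ω, Real.exp (t * ω) ∂shiftedGamma (α / β) α β
      = (Real.exp (-(t / β)) / (1 - t / β)) ^ α := by
  have h := integral_pow_mul_exp_shiftedGamma (ω₀ := α / β) hα hβ 0 ht
  have h1 : ∀ ω, Real.exp (t * ω) = Real.exp (-(t * (α / β))) *
      ((ω + α / β) ^ 0 * Real.exp (t * (ω + α / β))) := fun ω => by
    rw [pow_zero, one_mul, ← Real.exp_add]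
    ring_nf
  have hs := sub_pos.2 ht
  have hG := (Real.Gamma_pos_of_pos hα).ne'
  have h2 : 1 - t / β = (β - t) / β := by field_simp
  refine (integral_congr_ae (Filter.Eventually.of_forall h1)).trans ?_
  rw [integral_const_mul, h, h2, Real.div_rpow (Real.exp_pos _).le (by positivity), ← Real.exp_mul,
    Real.div_rpow hs.le hβ.le, Nat.cast_zero, add_zero, one_div, Real.inv_rpow hs.le]
  have := (Real.rpow_pos_of_pos hs α).ne'
  have := (Real.rpow_pos_of_pos hβ α).ne'
  rw [show -(t * (α / β)) = -(t / β) * α by ring]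
  field_simp

theorem integrable_polynomial_shiftedGamma (hα : 0 < α) (hβ : 0 < β) (p : Polynomial ℝ) :
    Integrable (fun ω => p.eval (ω + ω₀)) (shiftedGamma ω₀ α β) := by
  induction p using Polynomial.induction_on' with
  | add p q hp hq => exact (hp.add hq).congr (Filter.Eventually.of_forall fun ω => by simp)
  | monomial n a =>
    simpa using (integrable_pow_mul_exp_shiftedGamma (ω₀ := ω₀) hα hβ n hβ).const_mul a

/-- Integration by parts against a density with logarithmic derivative `(α - 1)/x - β`; on monomials
it is `Γ(s + 1) = s Γ(s)`. -/
theorem stein_shiftedGamma (hα : 0 < α) (hβ : 0 < β) (p : Polynomial ℝ) :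
    ∫ ω, ((Polynomial.C α - Polynomial.C β * Polynomial.X) * p
      + Polynomial.X * Polynomial.derivative p).eval (ω + ω₀) ∂shiftedGamma ω₀ α β = 0 := by
  induction p using Polynomial.induction_on' with
  | add p q hp hq =>
    have h := integral_add (integrable_polynomial_shiftedGamma (ω₀ := ω₀) hα hβ _)
      (integrable_polynomial_shiftedGamma (ω₀ := ω₀) hα hβ _) |>.trans (congrArg₂ (· + ·) hp hq)
    rw [add_zero] at h
    rw [← h]
    congr 1
    ext ω
    simp only [Polynomial.derivative_add, Polynomial.eval_add, Polynomial.eval_mul]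
    ring
  | monomial n a =>
    have hint : ∀ m : ℕ, Integrable (fun ω => (ω + ω₀) ^ m) (shiftedGamma ω₀ α β) := fun m => by
      simpa using integrable_pow_mul_exp_shiftedGamma (ω₀ := ω₀) hα hβ m hβ
    have hval : ∀ m : ℕ, ∫ ω, (ω + ω₀) ^ m ∂shiftedGamma ω₀ α β
        = β ^ α / Real.Gamma α * ((1 / β) ^ (α + m) * Real.Gamma (α + m)) := fun m => by
      simpa using integral_pow_mul_exp_shiftedGamma (ω₀ := ω₀) hα hβ m hβ
    have he : ∀ ω : ℝ, ((Polynomial.C α - Polynomial.C β * Polynomial.X) * Polynomial.monomial n a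
        + Polynomial.X * Polynomial.derivative (Polynomial.monomial n a)).eval (ω + ω₀)
        = (a * (α + n)) * (ω + ω₀) ^ n - (a * β) * (ω + ω₀) ^ (n + 1) := fun ω => by
      rcases n with _ | n
      · simp
        ring
      · simp
        ring
    simp_rw [he]
    rw [integral_sub ((hint n).const_mul _) ((hint (n + 1)).const_mul _), integral_const_mul,
      integral_const_mul, hval, hval]
    push_cast
    rw [← add_assoc, Real.Gamma_add_one (by positivity), Real.rpow_add (by positivity) _ 1,
      Real.rpow_one]
    field_simp
    ring

theorem integrable_pow_shiftedGamma (hα : 0 < α) (hβ : 0 < β) (n : ℕ) :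
    Integrable (fun ω => ω ^ n) (shiftedGamma ω₀ α β) := by
  have h := integrable_polynomial_shiftedGamma (ω₀ := ω₀) hα hβ
    ((Polynomial.X - Polynomial.C ω₀) ^ n)
  simpa using h

/-- Stein's identity for `(x - α/β)^(n+1)`: the shift is the mean, so `α - β x` becomes `-β ω`. -/
theorem integral_pow_shiftedGamma (hα : 0 < α) (hβ : 0 < β) (n : ℕ) :
    ∫ ω, ω ^ (n + 2) ∂shiftedGamma (α / β) α β = (n + 1) *
      (1 / β * ∫ ω, ω ^ (n + 1) ∂shiftedGamma (α / β) α β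
        + α / β ^ 2 * ∫ ω, ω ^ n ∂shiftedGamma (α / β) α β) := by
  have h := stein_shiftedGamma (ω₀ := α / β) hα hβ
    ((Polynomial.X - Polynomial.C (α / β)) ^ (n + 1))
  have hi := integrable_pow_shiftedGamma (ω₀ := α / β) hα hβ
  have he : ∀ ω : ℝ, ((Polynomial.C α - Polynomial.C β * Polynomial.X) *
      (Polynomial.X - Polynomial.C (α / β)) ^ (n + 1) + Polynomial.X * Polynomial.derivative
        ((Polynomial.X - Polynomial.C (α / β)) ^ (n + 1))).eval (ω + α / β)
      = (n + 1) * ω ^ (n + 1) + (n + 1) * (α / β) * ω ^ n - β * ω ^ (n + 2) := fun ω => by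
    simp [Polynomial.derivative_pow]
    field_simp
    ring
  simp_rw [he] at h
  have hadd : Integrable (fun ω => (n + 1) * ω ^ (n + 1) + (n + 1) * (α / β) * ω ^ n)
      (shiftedGamma (α / β) α β) := ((hi _).const_mul _).add ((hi _).const_mul _)
  rw [integral_sub hadd ((hi _).const_mul _),
    integral_add ((hi _).const_mul _) ((hi _).const_mul _), integral_const_mul, integral_const_mul,
    integral_const_mul] at h
  field_simp at h ⊢
  linear_combination -h

theorem integral_id_shiftedGamma (hα : 0 < α) (hβ : 0 < β) :
    ∫ ω, ω ^ 1 ∂shiftedGamma (α / β) α β = 0 := by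
  have h := stein_shiftedGamma (ω₀ := α / β) hα hβ 1
  have he : ∀ ω : ℝ, ((Polynomial.C α - Polynomial.C β * Polynomial.X) *
      1 + Polynomial.X * Polynomial.derivative 1).eval (ω + α / β) = -β * ω ^ 1 := fun ω => by
    simp
    field_simp
    ring
  simp_rw [he] at h
  rw [integral_const_mul] at h
  simpa [hβ.ne'] using h

theorem shiftedGamma_Iio (hα : 0 < α) (hβ : 0 < β) {b : ℝ} (hb : -ω₀ < b) :
    0 < shiftedGamma ω₀ α β (Set.Iio b) := by
  have hm : Measurable fun ω => gammaPDF α β (ω + ω₀) :=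
    ((measurable_gammaPDFReal α β).comp (measurable_add_const ω₀)).ennreal_ofReal
  rw [shiftedGamma, withDensity_apply _ measurableSet_Iio, setLIntegral_pos_iff hm]
  refine lt_of_lt_of_le ?_ (measure_mono (s := Set.Ioo (-ω₀) b) fun x hx => ⟨?_, hx.2⟩)
  · rw [Real.volume_Ioo]
    exact ENNReal.ofReal_pos.2 (by linarith)
  · have : 0 < x + ω₀ := by linarith [hx.1]
    exact (ENNReal.ofReal_pos.2 (gammaPDFReal_pos hα hβ this)).ne'

theorem shiftedGamma_Iio_eq_zero : shiftedGamma ω₀ α β (Set.Iio (-ω₀)) = 0 := by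
  rw [shiftedGamma, withDensity_apply _ measurableSet_Iio]
  refine (setLIntegral_congr_fun measurableSet_Iio fun x (hx : x < -ω₀) => ?_).trans lintegral_zero
  exact gammaPDF_of_neg (by linarith)

theorem isLeast_support_shiftedGamma (hα : 0 < α) (hβ : 0 < β) :
    IsLeast (shiftedGamma ω₀ α β).support (-ω₀) := by
  have hsub : (shiftedGamma ω₀ α β).support ⊆ Set.Ici (-ω₀) := by
    refine Measure.support_subset_of_isClosed isClosed_Ici ?_
    rw [mem_ae_iff, Set.compl_Ici]
    exact shiftedGamma_Iio_eq_zero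
  refine ⟨?_, fun x hx => hsub hx⟩
  rw [Measure.mem_support_iff_forall]
  intro U hU
  obtain ⟨ε, hε, hεU⟩ := Metric.mem_nhds_iff.1 hU
  have h1 := shiftedGamma_Iio (ω₀ := ω₀) hα hβ (b := -ω₀ + ε) (by linarith)
  have h2 : Set.Iio (-ω₀ + ε) ⊆ Set.Iio (-ω₀) ∪ U := fun x hx => by
    rcases lt_or_ge x (-ω₀) with h | h
    · exact Or.inl h
    · refine Or.inr (hεU ?_)
      rw [Metric.mem_ball, Real.dist_eq, abs_lt]
      constructor <;> linarith [Set.mem_Iio.1 hx]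
  have h3 := (measure_mono h2).trans (measure_union_le (μ := shiftedGamma ω₀ α β) _ _)
  rw [shiftedGamma_Iio_eq_zero, zero_add] at h3
  exact h1.trans_le h3

end ShiftedGamma

/-! ### The value of the energy bound -/

section Gaussian

/-- Since `((√f)')² = v² f/τ⁴`, the integral is the variance `τ²/2` of the normal law with density
`f`, divided by `τ⁴`. -/
theorem qeiBound_gaussian (c : ℝ) {τ : ℝ} (hτ : 0 < τ) :
    qeiBound c (gaussian τ) = -(c / (24 * Real.pi * τ ^ 2)) := by
  have hd : ∀ v, deriv (fun u => √(gaussian τ u)) v ^ 2 = 1 / τ ^ 4 * (gaussian τ v * v ^ 2) := by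
    intro v
    have hp := gaussian_pos hτ v
    rw [((hasDerivAt_gaussian τ v).sqrt hp.ne').deriv, div_pow, mul_pow 2 (√_), Real.sq_sqrt hp.le]
    field_simp
  obtain ⟨V, hV⟩ : ∃ V : NNReal, (V : ℝ) = τ ^ 2 / 2 := ⟨_, Real.coe_toNNReal _ (by positivity)⟩
  have hV0 : V ≠ 0 := by
    rw [← NNReal.coe_ne_zero, hV]
    positivity
  have hpdf : ∀ v, gaussianPDFReal 0 V v = gaussian τ v := by
    intro v
    have h1 : √(2 * Real.pi * (V : ℝ)) = τ * √Real.pi := by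
      rw [show 2 * Real.pi * (V : ℝ) = τ ^ 2 * Real.pi by rw [hV]; ring,
        Real.sqrt_mul (by positivity), Real.sqrt_sq hτ.le]
    rw [gaussianPDFReal, gaussian, h1, hV, mul_comm, ← div_eq_mul_inv]
    congr 2
    field_simp
    ring
  have h2 : ∫ v, gaussian τ v * v ^ 2 = τ ^ 2 / 2 := by
    have h3 := variance_of_integral_eq_zero (X := fun x : ℝ => x) (μ := gaussianReal 0 V)
      aemeasurable_id integral_id_gaussianReal
    rw [variance_fun_id_gaussianReal, integral_gaussianReal_eq_integral_smul hV0] at h3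
    simp only [hpdf, smul_eq_mul] at h3
    rw [← h3, hV]
  rw [qeiBound]
  simp_rw [hd]
  rw [integral_const_mul, h2]
  field_simp
  ring

end Gaussian

/-! ### Determinacy and polynomial density from exponential moments -/

section MomentProblem

/-- The measure has exponential moments of all rates less than `δ`. -/
def HasExpMoments (μ : Measure ℝ) (δ : ℝ) : Prop :=
  0 < δ ∧ ∀ t : ℝ, |t| < δ → Integrable (fun ω : ℝ => Real.exp (t * ω)) μ

variable {μ ν : Measure ℝ} {δ : ℝ}

namespace HasExpMoments

theorem mem_interior (hμ : HasExpMoments μ δ) {t : ℝ} (ht : |t| < δ) :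
    t ∈ interior (integrableExpSet (id : ℝ → ℝ) μ) := by
  refine _root_.mem_interior.2 ⟨Set.Ioo (-δ) δ, fun s hs => ?_, isOpen_Ioo, abs_lt.1 ht⟩
  exact hμ.2 s (abs_lt.2 hs)

theorem integrable_pow (hμ : HasExpMoments μ δ) (n : ℕ) : Integrable (fun ω : ℝ => ω ^ n) μ :=
  integrable_pow_of_mem_interior_integrableExpSet (hμ.mem_interior (by simpa using hμ.1)) n

theorem isFiniteMeasure (hμ : HasExpMoments μ δ) : IsFiniteMeasure μ := by
  have h := hμ.2 0 (by simpa using hμ.1)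
  simp only [zero_mul, Real.exp_zero] at h
  exact (integrable_const_iff.1 h).resolve_left one_ne_zero

theorem integrable_exp_abs (hμ : HasExpMoments μ δ) {t : ℝ} (ht : |t| < δ) :
    Integrable (fun ω : ℝ => Real.exp |t * ω|) μ := by
  refine ((hμ.2 t ht).add (hμ.2 (-t) (by rwa [abs_neg]))).mono' (by fun_prop)
    (Filter.Eventually.of_forall fun ω => ?_)
  rw [Real.norm_of_nonneg (Real.exp_pos _).le, Pi.add_apply, neg_mul]
  have h1 := Real.exp_pos (t * ω)
  have h2 := Real.exp_pos (-(t * ω))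
  rcases abs_choice (t * ω) with h | h <;> rw [h] <;> linarith

theorem hasSum_mgf (hμ : HasExpMoments μ δ) {t : ℝ} (ht : |t| < δ) :
    HasSum (fun n : ℕ => t ^ n * (∫ ω, ω ^ n ∂μ) / n.factorial) (∫ ω, Real.exp (t * ω) ∂μ) := by
  have hexp : ∀ x : ℝ, HasSum (fun n : ℕ => x ^ n / n.factorial) (Real.exp x) := fun x => by
    rw [Real.exp_eq_exp_ℝ]
    exact NormedSpace.expSeries_div_hasSum_exp x
  have h := hasSum_integral_of_dominated_convergence (μ := μ)
    (F := fun (n : ℕ) (ω : ℝ) => (t * ω) ^ n / n.factorial) (f := fun ω => Real.exp (t * ω))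
    (fun n ω => |t * ω| ^ n / n.factorial) (fun n => by fun_prop)
    (fun n => Filter.Eventually.of_forall fun ω => by simp)
    (Filter.Eventually.of_forall fun ω => (hexp _).summable)
    ((hμ.integrable_exp_abs ht).congr
      (Filter.Eventually.of_forall fun ω => (hexp _).tsum_eq.symm))
    (Filter.Eventually.of_forall fun ω => hexp _)
  convert! h using 2 with n
  rw [integral_div, ← integral_const_mul]
  simp_rw [mul_pow]

/-- A measure with the moments of a measure with exponential moments has exponential moments. -/
theorem of_moments (hμ : HasExpMoments μ δ) (hν : ∀ n : ℕ, Integrable (fun ω : ℝ => ω ^ n) ν)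
    (h : ∀ n : ℕ, ∫ ω, ω ^ n ∂ν = ∫ ω, ω ^ n ∂μ) : HasExpMoments ν δ := by
  refine ⟨hμ.1, fun t ht => ?_⟩
  have hnn : ∀ (k : ℕ) (ω : ℝ), 0 ≤ (t * ω) ^ (2 * k) / (2 * k).factorial := fun k ω =>
    div_nonneg ((even_two_mul k).pow_nonneg _) (by positivity)
  -- All terms of the `cosh` series are nonnegative, so its integral, finite or not, depends only on
  -- the even moments.
  have hcosh : ∀ ρ : Measure ℝ, (∀ n : ℕ, Integrable (fun ω : ℝ => ω ^ n) ρ) →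
      ∫⁻ ω, ENNReal.ofReal (Real.cosh (t * ω)) ∂ρ
        = ∑' k : ℕ, ENNReal.ofReal (t ^ (2 * k) * (∫ ω, ω ^ (2 * k) ∂ρ) / (2 * k).factorial) := by
    intro ρ hρ
    have h1 : ∀ ω : ℝ, ENNReal.ofReal (Real.cosh (t * ω))
        = ∑' k : ℕ, ENNReal.ofReal ((t * ω) ^ (2 * k) / (2 * k).factorial) := fun ω => by
      rw [← ENNReal.ofReal_tsum_of_nonneg (fun k => hnn k ω) (Real.hasSum_cosh _).summable,
        (Real.hasSum_cosh _).tsum_eq]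
    simp_rw [h1]
    rw [lintegral_tsum fun k => by fun_prop]
    refine tsum_congr fun k => ?_
    have h2 : ∀ ω : ℝ, (t * ω) ^ (2 * k) / (2 * k).factorial
        = t ^ (2 * k) / (2 * k).factorial * ω ^ (2 * k) := fun ω => by rw [mul_pow]; ring
    rw [← ofReal_integral_eq_lintegral_ofReal
      (((hρ (2 * k)).const_mul _).congr (Filter.Eventually.of_forall fun ω => (h2 ω).symm))
      (Filter.Eventually.of_forall (hnn k))]
    simp_rw [h2]
    rw [integral_const_mul]
    congr 1
    ring
  have hμc : Integrable (fun ω => Real.cosh (t * ω)) μ := by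
    refine (hμ.integrable_exp_abs ht).mono' (by fun_prop) (Filter.Eventually.of_forall fun ω => ?_)
    rw [Real.norm_of_nonneg (Real.cosh_pos _).le, Real.cosh_eq]
    have h1 := Real.exp_le_exp.2 (le_abs_self (t * ω))
    have h2 := Real.exp_le_exp.2 (neg_le_abs (t * ω))
    linarith
  have hpos : ∀ ρ : Measure ℝ, 0 ≤ᵐ[ρ] fun ω => Real.cosh (t * ω) := fun ρ =>
    Filter.Eventually.of_forall fun ω => (Real.cosh_pos _).le
  have hνc : Integrable (fun ω => Real.cosh (t * ω)) ν := by
    refine ⟨by fun_prop, (hasFiniteIntegral_iff_ofReal (hpos ν)).2 ?_⟩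
    have h1 := (hasFiniteIntegral_iff_ofReal (hpos μ)).1 hμc.2
    rw [hcosh μ hμ.integrable_pow] at h1
    rw [hcosh ν hν]
    simpa only [h] using h1
  refine (hνc.const_mul 2).mono' (by fun_prop) (Filter.Eventually.of_forall fun ω => ?_)
  rw [Real.norm_of_nonneg (Real.exp_pos _).le, Real.cosh_eq]
  have := Real.exp_pos (-(t * ω))
  linarith

/-- Exponential moments make the moment problem determinate. -/
theorem eq_of_moments (hμ : HasExpMoments μ δ) (hν : HasExpMoments ν δ)
    (h : ∀ n : ℕ, ∫ ω, ω ^ n ∂μ = ∫ ω, ω ^ n ∂ν) : μ = ν := by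
  have := hμ.isFiniteMeasure
  have := hν.isFiniteMeasure
  -- On this strip the complex moment generating functions are analytic. Their derivatives at `0`
  -- are the moments, and on the imaginary axis they are the characteristic functions.
  set S : Set ℂ := {z | z.re ∈ Set.Ioo (-δ) δ} with hS
  have hconv : Convex ℝ S := (convex_Ioo (-δ) δ).linear_preimage Complex.reLm
  have han : ∀ {ρ : Measure ℝ}, HasExpMoments ρ δ → AnalyticOnNhd ℂ (complexMGF id ρ) S :=
    fun {ρ} hρ z hz => analyticOnNhd_complexMGF z (hρ.mem_interior (abs_lt.2 hz))
  have h0 : (0 : ℂ) ∈ S := by simp [hS, hμ.1]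
  have hder : ∀ {ρ : Measure ℝ}, HasExpMoments ρ δ → ∀ n : ℕ,
      iteratedDeriv n (complexMGF id ρ) 0 = ((∫ ω, ω ^ n ∂ρ : ℝ) : ℂ) := by
    intro ρ hρ n
    rw [iteratedDeriv_complexMGF (hρ.mem_interior (by simpa using hρ.1))]
    refine Eq.trans ?_ (integral_ofReal (𝕜 := ℂ))
    simp
  have h1 := (han hμ 0 h0).hasFPowerSeriesAt.sub (han hν 0 h0).hasFPowerSeriesAt
  simp only [hder hμ, hder hν, h, sub_self] at h1
  have h2 : complexMGF id μ =ᶠ[nhds 0] complexMGF id ν := by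
    filter_upwards [h1.eventually_eq_zero] with z hz using sub_eq_zero.1 hz
  have h3 := (han hμ).eqOn_of_preconnected_of_eventuallyEq (han hν) hconv.isPreconnected h0 h2
  refine Measure.ext_of_charFun (funext fun t => ?_)
  rw [← complexMGF_id_mul_I, ← complexMGF_id_mul_I]
  exact h3 (by simp [hS, hμ.1])

theorem withDensity {h : ℝ → ℝ} (hδ : 0 < δ) (hm : Measurable h)
    (hh : ∀ t : ℝ, |t| < δ → Integrable (fun ω => Real.exp (t * ω) * h ω) μ) :
    HasExpMoments (μ.withDensity fun ω => ENNReal.ofReal (h ω)) δ := by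
  refine ⟨hδ, fun t ht => ?_⟩
  rw [integrable_withDensity_iff_integrable_smul' (by fun_prop)
    (Filter.Eventually.of_forall fun _ => ENNReal.ofReal_lt_top)]
  refine (hh t ht).mono (by fun_prop) (Filter.Eventually.of_forall fun ω => ?_)
  rw [smul_eq_mul, norm_mul, norm_mul, mul_comm]
  gcongr
  rw [ENNReal.toReal_ofReal', Real.norm_eq_abs, Real.norm_eq_abs]
  exact abs_max_le_max_abs_abs.trans (by simp)

/-- A function that is orthogonal to all polynomials vanishes. -/
theorem ae_eq_zero_of_measurable {h : ℝ → ℝ} (hδ : 0 < δ) (hm : Measurable h)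
    (hh : ∀ t : ℝ, |t| < δ → Integrable (fun ω => Real.exp (t * ω) * h ω) μ)
    (h0 : ∀ n : ℕ, ∫ ω, ω ^ n * h ω ∂μ = 0) : h =ᵐ[μ] 0 := by
  -- The positive and negative parts of `h` are densities of two measures with exponential moments.
  -- Orthogonality to polynomials makes their moments agree, hence the measures, hence the two
  -- parts.
  have hp := HasExpMoments.withDensity hδ hm hh
  have hn := HasExpMoments.withDensity (h := fun ω => -h ω) hδ hm.neg
    (fun t ht => by simpa using (hh t ht).neg)
  have hint : ∀ g : ℝ → ℝ, Measurable g → HasExpMoments (μ.withDensity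
      fun ω => ENNReal.ofReal (g ω)) δ → ∀ n : ℕ, Integrable (fun ω => max (g ω) 0 * ω ^ n) μ ∧
      ∫ ω, ω ^ n ∂(μ.withDensity fun ω => ENNReal.ofReal (g ω))
        = ∫ ω, max (g ω) 0 * ω ^ n ∂μ := by
    intro g hg he n
    have h1 := he.integrable_pow n
    rw [integrable_withDensity_iff_integrable_smul' (by fun_prop)
      (Filter.Eventually.of_forall fun _ => ENNReal.ofReal_lt_top)] at h1
    rw [integral_withDensity_eq_integral_toReal_smul (by fun_prop)
      (Filter.Eventually.of_forall fun _ => ENNReal.ofReal_lt_top)]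
    simp only [ENNReal.toReal_ofReal', smul_eq_mul] at h1 ⊢
    exact ⟨h1, trivial⟩
  have heq := hp.eq_of_moments hn fun n => by
    obtain ⟨i1, e1⟩ := hint h hm hp n
    obtain ⟨i2, e2⟩ := hint (fun ω => -h ω) hm.neg hn n
    rw [e1, e2, ← sub_eq_zero, ← integral_sub i1 i2]
    refine (integral_congr_ae (Filter.Eventually.of_forall fun ω => ?_)).trans (h0 n)
    rw [← sub_mul, max_zero_sub_max_neg_zero_eq_self, mul_comm]
  have hfin := hp.isFiniteMeasure
  have hfin' : ∫⁻ ω, ENNReal.ofReal (h ω) ∂μ ≠ ⊤ := by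
    have := measure_ne_top (μ.withDensity fun ω => ENNReal.ofReal (h ω)) Set.univ
    rwa [withDensity_apply _ MeasurableSet.univ, Measure.restrict_univ] at this
  rw [withDensity_eq_iff (by fun_prop) (by fun_prop) hfin'] at heq
  filter_upwards [heq] with ω hω
  rcases le_total (h ω) 0 with hle | hle
  · rw [ENNReal.ofReal_of_nonpos hle] at hω
    have := ENNReal.ofReal_eq_zero.1 hω.symm
    exact le_antisymm hle (neg_nonpos.1 this)
  · rw [ENNReal.ofReal_of_nonpos (p := -h ω) (by linarith)] at hω
    exact le_antisymm (ENNReal.ofReal_eq_zero.1 hω) hle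

theorem ae_eq_zero {h : ℝ → ℝ} (hδ : 0 < δ)
    (hh : ∀ t : ℝ, |t| < δ → Integrable (fun ω => Real.exp (t * ω) * h ω) μ)
    (h0 : ∀ n : ℕ, ∫ ω, ω ^ n * h ω ∂μ = 0) : h =ᵐ[μ] 0 := by
  have hm : AEStronglyMeasurable h μ := by
    simpa using (hh 0 (by simpa using hδ)).aestronglyMeasurable
  have he := hm.ae_eq_mk
  refine he.trans (ae_eq_zero_of_measurable hδ hm.stronglyMeasurable_mk.measurable
    (fun t ht => (hh t ht).congr (he.mono fun ω hω => by simp only [hω])) fun n => ?_)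
  rw [← h0 n]
  exact integral_congr_ae (he.mono fun ω hω => by simp only [hω])

end HasExpMoments

theorem memLp_eval (hμ : ∀ n : ℕ, Integrable (fun ω : ℝ => ω ^ n) μ) (p : Polynomial ℂ) :
    MemLp (fun ω : ℝ => p.eval (ω : ℂ)) 2 μ := by
  induction p using Polynomial.induction_on' with
  | add p q hp hq => simpa using! hp.add hq
  | monomial n a =>
    simp only [Polynomial.eval_monomial]
    refine MemLp.const_mul ((memLp_two_iff_integrable_sq_norm (by fun_prop)).2 ?_) a
    refine (hμ (2 * n)).congr (Filter.Eventually.of_forall fun ω => ?_)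
    simp only [norm_pow, Complex.norm_real, ← pow_mul, mul_comm n 2]
    rw [pow_mul, pow_mul, Real.norm_eq_abs, sq_abs]

/-- Polynomials as square integrable functions. -/
def polyLp (hμ : ∀ n : ℕ, Integrable (fun ω : ℝ => ω ^ n) μ) : Polynomial ℂ →ₗ[ℂ] Lp ℂ 2 μ where
  toFun p := (memLp_eval hμ p).toLp
  map_add' p q := by
    rw [← MemLp.toLp_add]
    congr 1
    ext ω
    simp
  map_smul' a p := by
    rw [RingHom.id_apply, ← MemLp.toLp_const_smul]
    congr 1
    ext ω
    simp

theorem inner_toLp {f g : ℝ → ℂ} (hf : MemLp f 2 μ) (hg : MemLp g 2 μ) :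
    inner ℂ hf.toLp hg.toLp = ∫ ω, conj (f ω) * g ω ∂μ := by
  rw [L2.inner_def]
  refine integral_congr_ae ?_
  filter_upwards [hf.coeFn_toLp, hg.coeFn_toLp] with ω h1 h2
  rw [h1, h2, RCLike.inner_apply']

theorem norm_toLp_le {f g : ℝ → ℂ} (hf : MemLp f 2 μ) (hg : MemLp g 2 μ)
    (h : ∀ ω, ‖f ω‖ ≤ ‖g ω‖) : ‖hf.toLp‖ ≤ ‖hg.toLp‖ := by
  have := Lp.norm_le_mul_norm_of_ae_le_mul (c := 1) (f := hf.toLp) (g := hg.toLp) (by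
    filter_upwards [hf.coeFn_toLp, hg.coeFn_toLp] with ω h1 h2
    rw [h1, h2, one_mul]
    exact h ω)
  rwa [one_mul] at this

/-- Multiples of `ω - i` are dense among the square integrable functions. -/
theorem HasExpMoments.dense_range (hμ : HasExpMoments μ δ) :
    ((polyLp hμ.integrable_pow).comp
      (LinearMap.mulLeft ℂ (Polynomial.X - Polynomial.C Complex.I))).range.topologicalClosure
      = ⊤ := by
  have := hμ.isFiniteMeasure
  rw [Submodule.topologicalClosure_eq_top_iff, Submodule.eq_bot_iff]
  intro g hg
  have hgm := Lp.memLp g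
  -- Orthogonality of `g` to all `(ω - i) p` is orthogonality of `(ω + i) g` to all polynomials, and
  -- `ω + i` has no real zero.
  set k : ℝ → ℂ := fun ω => (ω + Complex.I) * g ω with hk
  have hδ2 : 0 < δ / 2 := half_pos hμ.1
  -- Square integrability of `exp(t ω)` uses the rate `2t`; hence the halved `δ`.
  have hmem : ∀ t : ℝ, |t| < δ / 2 →
      MemLp (fun ω : ℝ => (Real.exp (t * ω) : ℂ) * (ω + Complex.I)) 2 μ := by
    intro t ht
    refine (memLp_two_iff_integrable_sq_norm (by fun_prop)).2 ?_
    have h2t : |2 * t| < δ := by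
      rw [abs_mul, abs_two]
      linarith
    have h1 := integrable_pow_mul_exp_of_mem_interior_integrableExpSet (hμ.mem_interior h2t)
    refine ((h1 2).add (h1 0)).congr (Filter.Eventually.of_forall fun ω => ?_)
    have h2 : ‖(ω : ℂ) + Complex.I‖ ^ 2 = ω ^ 2 + 1 := by
      rw [← Complex.normSq_eq_norm_sq, Complex.normSq_apply]
      simp
      ring
    simp only [Pi.add_apply, id, norm_mul, mul_pow, h2, Complex.norm_real, Real.norm_eq_abs,
      Real.abs_exp, ← Real.exp_nat_mul]
    push_cast
    ring_nf
  have hkint : ∀ t : ℝ, |t| < δ / 2 → Integrable (fun ω : ℝ => (Real.exp (t * ω) : ℂ) * k ω) μ := by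
    intro t ht
    refine ((hmem t ht).integrable_mul hgm).congr (Filter.Eventually.of_forall fun ω => ?_)
    simp only [hk, Pi.mul_apply]
    ring
  have horth : ∀ n : ℕ, Integrable (fun ω : ℝ => (ω : ℂ) ^ n * k ω) μ ∧
      ∫ ω : ℝ, (ω : ℂ) ^ n * k ω ∂μ = 0 := by
    intro n
    have h1 := (Submodule.mem_orthogonal _ _).1 hg _
      (LinearMap.mem_range_self _ ((Polynomial.X : Polynomial ℂ) ^ n))
    have he := hgm.coeFn_toLp
    have h2 := inner_toLp (memLp_eval hμ.integrable_pow
      ((Polynomial.X - Polynomial.C Complex.I) * (Polynomial.X : Polynomial ℂ) ^ n)) hgm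
    rw [Lp.toLp_coeFn] at h2
    have h3 : ∀ ω : ℝ, conj (((Polynomial.X - Polynomial.C Complex.I) *
        (Polynomial.X : Polynomial ℂ) ^ n).eval (ω : ℂ)) = (ω + Complex.I) * (ω : ℂ) ^ n :=
      fun ω => by simp
    constructor
    · have h4 := (memLp_eval hμ.integrable_pow ((Polynomial.X + Polynomial.C Complex.I) *
        (Polynomial.X : Polynomial ℂ) ^ n)).integrable_mul hgm
      refine h4.congr (Filter.Eventually.of_forall fun ω => ?_)
      simp [hk]
      ring
    · rw [← h1]
      refine Eq.trans ?_ h2.symm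
      refine integral_congr_ae (Filter.Eventually.of_forall fun ω => ?_)
      simp only [h3, hk]
      ring
  have hre : (fun ω => (k ω).re) =ᵐ[μ] 0 := by
    refine HasExpMoments.ae_eq_zero hδ2 (fun t ht => ?_) fun n => ?_
    · refine (hkint t ht).re.congr (Filter.Eventually.of_forall fun ω => ?_)
      exact Complex.re_ofReal_mul _ _
    · have h1 := congrArg Complex.re (horth n).2
      refine Eq.trans (integral_congr_ae (Filter.Eventually.of_forall fun ω => ?_))
        ((integral_re (horth n).1).trans h1)
      simp only [← Complex.ofReal_pow]
      exact (Complex.re_ofReal_mul _ _).symm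
  have him : (fun ω => (k ω).im) =ᵐ[μ] 0 := by
    refine HasExpMoments.ae_eq_zero hδ2 (fun t ht => ?_) fun n => ?_
    · refine (hkint t ht).im.congr (Filter.Eventually.of_forall fun ω => ?_)
      exact Complex.im_ofReal_mul _ _
    · have h1 := congrArg Complex.im (horth n).2
      refine Eq.trans (integral_congr_ae (Filter.Eventually.of_forall fun ω => ?_))
        ((integral_im (horth n).1).trans h1)
      simp only [← Complex.ofReal_pow]
      exact (Complex.im_ofReal_mul _ _).symm
  rw [Lp.eq_zero_iff_ae_eq_zero]
  filter_upwards [hre, him] with ω h1 h2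
  have h3 : k ω = 0 := Complex.ext h1 h2
  refine (mul_eq_zero.1 h3).resolve_left fun h4 => ?_
  simpa using congrArg Complex.im h4

/-- Polynomials approximate square integrable functions in the graph norm of multiplication by the
variable. -/
theorem HasExpMoments.exists_poly_tendsto (hμ : HasExpMoments μ δ) {r : ℝ → ℂ}
    (hr : MemLp r 2 μ) (hxr : MemLp (fun ω : ℝ => (ω : ℂ) * r ω) 2 μ) :
    ∃ p : ℕ → Polynomial ℂ,
      Filter.Tendsto (fun k => polyLp hμ.integrable_pow (p k)) Filter.atTop (nhds hr.toLp) ∧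
      Filter.Tendsto (fun k => polyLp hμ.integrable_pow (Polynomial.X * p k)) Filter.atTop
        (nhds hxr.toLp) := by
  -- Approximate `(ω - i) r` by multiples `(X - i) p`. As `|ω - i| ≥ 1`, this forces `p → r`, and
  -- then `X p = (X - i) p + i p` converges too.
  have hu := hxr.sub (hr.const_mul Complex.I)
  have hmem : hu.toLp ∈ closure (((polyLp hμ.integrable_pow).comp
      (LinearMap.mulLeft ℂ (Polynomial.X - Polynomial.C Complex.I))).range : Set (Lp ℂ 2 μ)) := by
    rw [← Submodule.topologicalClosure_coe, hμ.dense_range]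
    trivial
  obtain ⟨x, hx, hlim⟩ := mem_closure_iff_seq_limit.1 hmem
  choose p hp using fun n => hx n
  have hq : ∀ n, polyLp hμ.integrable_pow ((Polynomial.X - Polynomial.C Complex.I) * p n) = x n :=
    hp
  have h1 : Filter.Tendsto (fun k => polyLp hμ.integrable_pow (p k)) Filter.atTop
      (nhds hr.toLp) := by
    rw [tendsto_iff_norm_sub_tendsto_zero] at hlim ⊢
    refine squeeze_zero (fun _ => norm_nonneg _) (fun n => ?_) hlim
    rw [← hq]
    change ‖(memLp_eval hμ.integrable_pow (p n)).toLp - hr.toLp‖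
      ≤ ‖(memLp_eval hμ.integrable_pow _).toLp - hu.toLp‖
    rw [← MemLp.toLp_sub, ← MemLp.toLp_sub]
    refine norm_toLp_le _ _ fun ω => ?_
    have h2 : ((Polynomial.X - Polynomial.C Complex.I) * p n).eval (ω : ℂ)
        - (ω * r ω - Complex.I * r ω) = (ω - Complex.I) * ((p n).eval (ω : ℂ) - r ω) := by
      simp
      ring
    simp only [Pi.sub_apply]
    rw [h2, norm_mul]
    have h3 : 1 ≤ ‖(ω : ℂ) - Complex.I‖ := by
      have := Complex.abs_im_le_norm ((ω : ℂ) - Complex.I)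
      simpa using this
    exact le_mul_of_one_le_left (norm_nonneg _) h3
  refine ⟨p, h1, ?_⟩
  have h2 := hlim.add (h1.const_smul Complex.I)
  have h3 : hu.toLp + Complex.I • hr.toLp = hxr.toLp := by
    rw [← MemLp.toLp_const_smul, ← MemLp.toLp_add]
    congr 1
    ext ω
    simp
  rw [h3] at h2
  refine h2.congr fun n => ?_
  rw [← hq, ← map_smul, ← map_add]
  congr 1
  rw [Polynomial.smul_eq_C_mul]
  ring

end MomentProblem

/-! ### The vacuum spectral law and sharpness of the bound -/

section Measurement

variable {P : Measure ℝ} {δ : ℝ}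

theorem inner_polyLp_monomial (hP : ∀ n : ℕ, Integrable (fun ω : ℝ => ω ^ n) P) (m n : ℕ)
    (a b : ℂ) : inner ℂ (polyLp hP (Polynomial.monomial m a)) (polyLp hP (Polynomial.monomial n b))
      = conj a * b * ((∫ ω, ω ^ (m + n) ∂P : ℝ) : ℂ) := by
  refine (inner_toLp (memLp_eval hP _) (memLp_eval hP _)).trans ?_
  rw [show ((∫ ω, ω ^ (m + n) ∂P : ℝ) : ℂ) = ∫ ω, ((ω ^ (m + n) : ℝ) : ℂ) ∂P from
    (integral_ofReal (𝕜 := ℂ)).symm, ← integral_const_mul]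
  refine integral_congr_ae (Filter.Eventually.of_forall fun ω => ?_)
  simp [pow_add]
  ring

namespace ChiralCFT

variable {H : Type*} [NormedAddCommGroup H] [InnerProductSpace ℂ H] {c : ℝ} (𝒞 : ChiralCFT H c)
  {f : LineFn}

/-- The vector `p(T(f)) Ω` for a polynomial `p`. -/
def polyVec (f : LineFn) (p : Polynomial ℂ) : 𝒞.D := Polynomial.aeval (𝒞.T f) p 𝒞.Ω

theorem polyVec_add (p q : Polynomial ℂ) : 𝒞.polyVec f (p + q) = 𝒞.polyVec f p + 𝒞.polyVec f q := by
  simp [polyVec]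

theorem polyVec_sub (p q : Polynomial ℂ) : 𝒞.polyVec f (p - q) = 𝒞.polyVec f p - 𝒞.polyVec f q := by
  simp [polyVec]

theorem polyVec_one : 𝒞.polyVec f 1 = 𝒞.Ω := by simp [polyVec]

theorem polyVec_X_mul (p : Polynomial ℂ) :
    𝒞.polyVec f (Polynomial.X * p) = 𝒞.T f (𝒞.polyVec f p) := by
  simp [polyVec]

theorem polyVec_monomial (n : ℕ) (a : ℂ) :
    𝒞.polyVec f (Polynomial.monomial n a) = a • (𝒞.T f ^ n) 𝒞.Ω := by
  simp [polyVec, Polynomial.aeval_monomial, Algebra.algebraMap_eq_smul_one]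

theorem inner_pow_right
    (hT : ∀ φ ψ : 𝒞.D, inner ℂ (φ : H) (𝒞.T f ψ : H) = inner ℂ (𝒞.T f φ : H) (ψ : H)) (n : ℕ)
    (φ ψ : 𝒞.D) :
    inner ℂ ((𝒞.T f ^ n) φ : H) (ψ : H) = inner ℂ (φ : H) ((𝒞.T f ^ n) ψ : H) := by
  induction n generalizing φ ψ with
  | zero => simp
  | succ n ih =>
    rw [T_pow_succ_apply, ← hT, ih, ← Module.End.mul_apply, ← pow_succ]

/-- By symmetry of `T(f)` all factors can be collected on one side, so on monomials both inner
products are the moment of order `m + n`. Limits in `L²(P)` can therefore be transported to `H`. -/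
theorem inner_polyVec
    (hT : ∀ φ ψ : 𝒞.D, inner ℂ (φ : H) (𝒞.T f ψ : H) = inner ℂ (𝒞.T f φ : H) (ψ : H))
    (hP : ∀ n : ℕ, Integrable (fun ω : ℝ => ω ^ n) P) (hm : HasMoments P (𝒞.moment f))
    (p q : Polynomial ℂ) :
    inner ℂ (𝒞.polyVec f p : H) (𝒞.polyVec f q : H) = inner ℂ (polyLp hP p) (polyLp hP q) := by
  induction p using Polynomial.induction_on' with
  | add p₁ p₂ h₁ h₂ =>
    rw [polyVec_add, map_add, Submodule.coe_add, inner_add_left, inner_add_left, h₁, h₂]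
  | monomial m a =>
    induction q using Polynomial.induction_on' with
    | add q₁ q₂ h₁ h₂ =>
      rw [polyVec_add, map_add, Submodule.coe_add, inner_add_right, inner_add_right, h₁, h₂]
    | monomial n b =>
      rw [inner_polyLp_monomial, (hm (m + n)).2, polyVec_monomial, polyVec_monomial,
        Submodule.coe_smul, Submodule.coe_smul, inner_smul_left, inner_smul_right,
        𝒞.inner_pow_right hT, ← Module.End.mul_apply, ← pow_add, moment]
      ring

theorem norm_polyVec
    (hT : ∀ φ ψ : 𝒞.D, inner ℂ (φ : H) (𝒞.T f ψ : H) = inner ℂ (𝒞.T f φ : H) (ψ : H))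
    (hP : ∀ n : ℕ, Integrable (fun ω : ℝ => ω ^ n) P) (hm : HasMoments P (𝒞.moment f))
    (p : Polynomial ℂ) : ‖(𝒞.polyVec f p : H)‖ = ‖polyLp hP p‖ := by
  rw [@norm_eq_sqrt_re_inner ℂ, @norm_eq_sqrt_re_inner ℂ, 𝒞.inner_polyVec hT hP hm]

theorem norm_polyVec_sub
    (hT : ∀ φ ψ : 𝒞.D, inner ℂ (φ : H) (𝒞.T f ψ : H) = inner ℂ (𝒞.T f φ : H) (ψ : H))
    (hP : ∀ n : ℕ, Integrable (fun ω : ℝ => ω ^ n) P) (hm : HasMoments P (𝒞.moment f))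
    (p q : Polynomial ℂ) :
    ‖(𝒞.polyVec f p : H) - (𝒞.polyVec f q : H)‖ = ‖polyLp hP p - polyLp hP q‖ := by
  rw [← map_sub, ← 𝒞.norm_polyVec hT hP hm, polyVec_sub, Submodule.coe_sub]

theorem exists_tendsto_polyVec [CompleteSpace H]
    (hT : ∀ φ ψ : 𝒞.D, inner ℂ (φ : H) (𝒞.T f ψ : H) = inner ℂ (𝒞.T f φ : H) (ψ : H))
    (hP : ∀ n : ℕ, Integrable (fun ω : ℝ => ω ^ n) P) (hm : HasMoments P (𝒞.moment f))
    {p : ℕ → Polynomial ℂ} {r : Lp ℂ 2 P}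
    (h : Filter.Tendsto (fun k => polyLp hP (p k)) Filter.atTop (nhds r)) :
    ∃ y : H, Filter.Tendsto (fun k => (𝒞.polyVec f (p k) : H)) Filter.atTop (nhds y) := by
  refine cauchySeq_tendsto_of_complete (Metric.cauchySeq_iff'.2 fun ε hε => ?_)
  obtain ⟨N, hN⟩ := Metric.cauchySeq_iff'.1 h.cauchySeq ε hε
  refine ⟨N, fun n hn => ?_⟩
  have := hN n hn
  rw [dist_eq_norm] at this ⊢
  rwa [𝒞.norm_polyVec_sub hT hP hm]

/-- If the vacuum moments of a symmetric field are the moments of a measure with exponential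
moments, then that measure is the law of the measurements in the vacuum. -/
theorem isMeasurementLaw [CompleteSpace H]
    (hT : ∀ φ ψ : 𝒞.D, inner ℂ (φ : H) (𝒞.T f ψ : H) = inner ℂ (𝒞.T f φ : H) (ψ : H))
    (hP : HasExpMoments P δ) (hm : HasMoments P (𝒞.moment f)) {A : H →ₗ.[ℂ] H}
    (hA : IsSelfAdjoint A) (hTA : 𝒞.unboundedT f ≤ A) : IsMeasurementLaw A (𝒞.Ω : H) P := by
  have hfin := hP.isFiniteMeasure
  refine ⟨hfin, fun z hz => ?_⟩
  have hne : ∀ ω : ℝ, (ω : ℂ) - z ≠ 0 := fun ω h => hz (by simpa using congrArg Complex.im h)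
  have hlow : ∀ ω : ℝ, |z.im| ≤ ‖(ω : ℂ) - z‖ := fun ω => by
    simpa using Complex.abs_im_le_norm ((ω : ℂ) - z)
  have hzi : 0 < |z.im| := abs_pos.2 hz
  have hone : MemLp (fun _ : ℝ => (1 : ℂ)) 2 P := memLp_const 1
  have hr : MemLp (fun ω : ℝ => ((ω : ℂ) - z)⁻¹) 2 P := by
    refine MemLp.of_bound (by fun_prop) |z.im|⁻¹ (Filter.Eventually.of_forall fun ω => ?_)
    rw [norm_inv]
    exact inv_anti₀ hzi (hlow ω)
  have hxe : (fun ω : ℝ => (ω : ℂ) * ((ω : ℂ) - z)⁻¹)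
      = fun ω : ℝ => 1 + z * ((ω : ℂ) - z)⁻¹ := by
    ext ω
    have := hne ω
    field_simp
    ring
  have hxr : MemLp (fun ω : ℝ => (ω : ℂ) * ((ω : ℂ) - z)⁻¹) 2 P := by
    rw [hxe]
    exact hone.add (hr.const_mul z)
  -- The vectors `p k (T(f)) Ω` will converge to the resolvent vector `y`, and their images under
  -- `T(f)` to `Ω + z y`, as `ω/(ω - z) = 1 + z/(ω - z)`.
  obtain ⟨p, hp1, hp2⟩ := hP.exists_poly_tendsto hr hxr
  have hlp1 : polyLp hP.integrable_pow 1 = hone.toLp := by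
    change (memLp_eval hP.integrable_pow _).toLp = _
    congr 1
    ext ω
    simp
  obtain ⟨y, hy⟩ := 𝒞.exists_tendsto_polyVec hT hP.integrable_pow hm hp1
  have hTy : Filter.Tendsto (fun k => (𝒞.polyVec f (Polynomial.X * p k) : H)) Filter.atTop
      (nhds ((𝒞.Ω : H) + z • y)) := by
    have h1 : Filter.Tendsto (fun k => (𝒞.polyVec f (Polynomial.X * p k) : H)
        - ((𝒞.Ω : H) + z • (𝒞.polyVec f (p k) : H))) Filter.atTop (nhds 0) := by
      rw [tendsto_zero_iff_norm_tendsto_zero]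
      have h2 := hp2.sub ((tendsto_const_nhds (x := polyLp hP.integrable_pow 1)).add
        (hp1.const_smul z))
      have h3 : hxr.toLp - (polyLp hP.integrable_pow 1 + z • hr.toLp) = 0 := by
        rw [hlp1, ← MemLp.toLp_const_smul, ← MemLp.toLp_add, ← MemLp.toLp_sub]
        convert! MemLp.toLp_zero (MemLp.zero (ε := ℂ) (p := 2) (μ := P))
        ext ω
        have := congrFun hxe ω
        simp only [Pi.sub_apply, Pi.add_apply, Pi.smul_apply, smul_eq_mul, Pi.zero_apply]
        rw [this, sub_self]
      rw [h3] at h2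
      refine h2.norm.congr' (Filter.Eventually.of_forall fun k => ?_) |>.trans (by simp)
      have h4 : (𝒞.Ω : H) + z • (𝒞.polyVec f (p k) : H)
          = (𝒞.polyVec f (1 + Polynomial.C z * p k) : H) := by
        rw [polyVec_add, polyVec_one]
        simp [polyVec, Algebra.algebraMap_eq_smul_one]
      rw [h4, 𝒞.norm_polyVec_sub hT hP.integrable_pow hm, map_add, ← Polynomial.smul_eq_C_mul,
        map_smul]
    have h5 := h1.add ((tendsto_const_nhds (x := (𝒞.Ω : H))).add (hy.const_smul z))
    rw [zero_add] at h5
    exact h5.congr fun k => by abel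
  -- Self-adjointness enters only through closedness of the graph, which admits the limit of the
  -- polynomial vectors.
  have hcl : IsClosed (A.graph : Set (H × H)) := hA.isClosed
  have hmem : (y, (𝒞.Ω : H) + z • y) ∈ A.graph := by
    refine hcl.mem_of_tendsto (hy.prodMk_nhds hTy) (Filter.Eventually.of_forall fun k => ?_)
    refine LinearPMap.le_graph_of_le hTA ?_
    rw [polyVec_X_mul]
    exact (𝒞.unboundedT f).mem_graph (𝒞.polyVec f (p k))
  obtain ⟨w, hw1, hw2⟩ := (LinearPMap.mem_graph_iff A).1 hmem
  simp only at hw1 hw2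
  refine ⟨w, by rw [hw2, hw1, add_sub_cancel_right], ?_⟩
  rw [hw1]
  have h6 : Filter.Tendsto (fun k => inner ℂ (𝒞.Ω : H) (𝒞.polyVec f (p k) : H)) Filter.atTop
      (nhds (inner ℂ (𝒞.Ω : H) y)) := tendsto_const_nhds.inner hy
  have h7 : Filter.Tendsto (fun k => inner ℂ (𝒞.Ω : H) (𝒞.polyVec f (p k) : H)) Filter.atTop
      (nhds (inner ℂ (polyLp hP.integrable_pow 1) hr.toLp)) := by
    refine (tendsto_const_nhds.inner hp1).congr fun k => ?_
    rw [← 𝒞.inner_polyVec hT hP.integrable_pow hm, polyVec_one]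
  rw [tendsto_nhds_unique h6 h7, hlp1, inner_toLp]
  simp

/-- Every lower bound of the expectation values lies below the law of the measurements in the
vacuum. -/
theorem measure_Ico_eq_zero_of_lowerBound
    (hT : ∀ φ ψ : 𝒞.D, inner ℂ (φ : H) (𝒞.T f ψ : H) = inner ℂ (𝒞.T f φ : H) (ψ : H))
    (hP : HasExpMoments P δ) (hm : HasMoments P (𝒞.moment f)) {a b : ℝ}
    (hb : b ∈ lowerBounds (𝒞.expectations f)) : P (Set.Ico a b) = 0 := by
  have hfin := hP.isFiniteMeasure
  have hexp : ∀ ψ : 𝒞.D, b * ‖(ψ : H)‖ ^ 2 ≤ (inner ℂ (ψ : H) (𝒞.T f ψ : H)).re := by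
    intro ψ
    rcases eq_or_ne ‖(ψ : H)‖ 0 with h0 | h0
    · rw [norm_eq_zero.1 h0]
      simp
    · set n : ℂ := ((‖(ψ : H)‖⁻¹ : ℝ) : ℂ) with hn
      have h1 : ‖((n • ψ : 𝒞.D) : H)‖ = 1 := by
        rw [Submodule.coe_smul, norm_smul, hn, Complex.norm_real, norm_inv, norm_norm,
          inv_mul_cancel₀ h0]
      have hreal : ∀ φ : 𝒞.D, (((inner ℂ (φ : H) (𝒞.T f φ : H)).re : ℝ) : ℂ)
          = inner ℂ (φ : H) (𝒞.T f φ : H) := fun φ => by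
        rw [← Complex.conj_eq_iff_re, inner_conj_symm, hT]
      have h2 := hb ⟨n • ψ, h1, hreal _⟩
      rw [map_smul, Submodule.coe_smul, Submodule.coe_smul, inner_smul_left, inner_smul_right, hn,
        Complex.conj_ofReal, Complex.re_ofReal_mul, Complex.re_ofReal_mul] at h2
      have h3 : 0 < ‖(ψ : H)‖ := lt_of_le_of_ne (norm_nonneg _) (Ne.symm h0)
      rw [← mul_assoc, ← mul_inv, inv_mul_eq_div, le_div_iff₀ (by positivity)] at h2
      rwa [sq]
  -- The indicator stands in for the vacuum projected to spectral values in `[a, b)`; polynomial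
  -- vectors approximate it together with its image under multiplication by `ω`.
  set r : ℝ → ℂ := (Set.Ico a b).indicator fun _ => 1 with hr
  have hrm : MemLp r 2 P := (memLp_const 1).indicator measurableSet_Ico
  have hxm : MemLp (fun ω : ℝ => (ω : ℂ) * r ω) 2 P := by
    refine MemLp.of_bound (Complex.measurable_ofReal.aestronglyMeasurable.mul
      hrm.aestronglyMeasurable) (max |a| |b|) (Filter.Eventually.of_forall fun ω => ?_)
    by_cases hω : ω ∈ Set.Ico a b
    · rw [hr, Set.indicator_of_mem hω, mul_one, Complex.norm_real]
      exact abs_le_max_abs_abs hω.1 hω.2.le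
    · rw [hr, Set.indicator_of_notMem hω, mul_zero, norm_zero]
      positivity
  obtain ⟨p, hp1, hp2⟩ := hP.exists_poly_tendsto hrm hxm
  have h1 : b * ‖hrm.toLp‖ ^ 2 ≤ (inner ℂ hrm.toLp hxm.toLp).re := by
    refine le_of_tendsto_of_tendsto' ((hp1.norm.pow 2).const_mul b)
      (Complex.continuous_re.continuousAt.tendsto.comp (hp1.inner hp2)) fun k => ?_
    have h2 := hexp (𝒞.polyVec f (p k))
    rwa [𝒞.norm_polyVec hT hP.integrable_pow hm, ← polyVec_X_mul,
      𝒞.inner_polyVec hT hP.integrable_pow hm] at h2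
  have h3 : ‖hrm.toLp‖ ^ 2 = (inner ℂ hrm.toLp hrm.toLp).re := (inner_self_eq_norm_sq (𝕜 := ℂ) _).symm
  have hi : ∀ g : ℝ → ℝ, Set.indicator (Set.Ico a b) g = fun ω => (conj (r ω) * (g ω * r ω)).re := by
    intro g
    ext ω
    by_cases hω : ω ∈ Set.Ico a b
    · simp [hr, hω]
    · simp [hr, hω]
  have hconj : MemLp (fun ω => conj (r ω)) 2 P := hrm.star
  have i1 : Integrable (fun ω => conj (r ω) * r ω) P := hconj.integrable_mul hrm
  have i2 : Integrable (fun ω => conj (r ω) * ((ω : ℂ) * r ω)) P := hconj.integrable_mul hxm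
  have e1 : ∫ ω in Set.Ico a b, (1 : ℝ) ∂P = ‖hrm.toLp‖ ^ 2 := by
    rw [h3, inner_toLp, ← integral_indicator measurableSet_Ico, hi]
    simpa using integral_re i1
  have e2 : ∫ ω in Set.Ico a b, ω ∂P = (inner ℂ hrm.toLp hxm.toLp).re := by
    rw [inner_toLp, ← integral_indicator measurableSet_Ico, hi]
    exact integral_re i2
  have j1 : IntegrableOn (fun ω : ℝ => ω) (Set.Ico a b) P := by
    simpa using (hP.integrable_pow 1).integrableOn
  have j2 : IntegrableOn (fun _ : ℝ => b) (Set.Ico a b) P := (integrable_const b).integrableOn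
  -- A strictly positive function on `[a, b)` with nonpositive integral: the set must be null.
  have h4 : ∫ ω in Set.Ico a b, (b - ω) ∂P ≤ 0 := by
    rw [integral_sub j2 j1, e2]
    have : ∫ _ in Set.Ico a b, b ∂P = b * ∫ _ in Set.Ico a b, (1 : ℝ) ∂P := by
      rw [← integral_const_mul]
      simp
    rw [this, e1]
    linarith
  have h5 : 0 ≤ᵐ[P.restrict (Set.Ico a b)] fun ω => b - ω := by
    filter_upwards [ae_restrict_mem measurableSet_Ico] with ω hω using sub_nonneg.2 hω.2.le
  have h6 := (integral_eq_zero_iff_of_nonneg_ae h5 (j2.sub j1)).1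
    (le_antisymm h4 (integral_nonneg_of_ae h5))
  by_contra hne
  have h7 : ∀ᵐ _ ∂P.restrict (Set.Ico a b), False := by
    filter_upwards [h6, ae_restrict_mem measurableSet_Ico] with ω h8 h9
    have : b - ω = 0 := h8
    linarith [h9.2]
  rw [Filter.eventually_false_iff_eq_bot, ae_eq_bot, Measure.restrict_eq_zero] at h7
  exact hne h7

end ChiralCFT

end Measurement

end CFT

end

/-! ### Assembly of the main theorem -/

theorem mainTheorem5 {H : Type*} [NormedAddCommGroup H] [InnerProductSpace ℂ H] [CompleteSpace H]
    {c : ℝ} (hc : 0 < c) (𝒞 : CFT.ChiralCFT H c) {τ : ℝ} (hτ : 0 < τ) (P : Measure ℝ)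
    (hP : P = CFT.shiftedGamma (c / (24 * Real.pi * τ ^ 2)) (c / 24) (Real.pi * τ ^ 2)) :
    -- the moment generating function
    (∀ μ : ℝ, |μ| < Real.pi * τ ^ 2 →
      HasSum (fun n : ℕ => (μ : ℂ) ^ n * 𝒞.moment (CFT.gaussianFn hτ) n / (n.factorial : ℂ))
        (((Real.exp (-(μ / (Real.pi * τ ^ 2))) / (1 - μ / (Real.pi * τ ^ 2))) ^ (c / 24) : ℝ) :
          ℂ)) ∧
    -- the shifted Gamma distribution is a probability distribution with this moment generating
    -- function and with the vacuum moments
    IsProbabilityMeasure P ∧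
    (∀ μ : ℝ, μ < Real.pi * τ ^ 2 → Integrable (fun ω : ℝ => Real.exp (μ * ω)) P ∧
      ∫ ω, Real.exp (μ * ω) ∂P =
        (Real.exp (-(μ / (Real.pi * τ ^ 2))) / (1 - μ / (Real.pi * τ ^ 2))) ^ (c / 24)) ∧
    CFT.HasMoments P (𝒞.moment (CFT.gaussianFn hτ)) ∧
    -- it is the only measure with these moments
    (∀ ν : Measure ℝ, CFT.HasMoments ν (𝒞.moment (CFT.gaussianFn hτ)) → ν = P) ∧
    -- it is the law of the outcomes of measurements of the smeared stress tensor in the vacuum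
    (∀ A : H →ₗ.[ℂ] H, IsSelfAdjoint A → 𝒞.unboundedT (CFT.gaussianFn hτ) ≤ A →
      CFT.IsMeasurementLaw A (𝒞.Ω : H) P) ∧
    -- the lower end of its support is the sharp quantum energy inequality bound
    IsLeast P.support (CFT.qeiBound c (CFT.gaussian τ)) ∧
    IsGLB (𝒞.expectations (CFT.gaussianFn hτ)) (CFT.qeiBound c (CFT.gaussian τ)) ∧
    CFT.qeiBound c (CFT.gaussian τ) = -(c / (24 * Real.pi * τ ^ 2)) := by
  have hα : 0 < c / 24 := by positivity
  have hβ : 0 < Real.pi * τ ^ 2 := by positivity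
  have hω₀ : c / (24 * Real.pi * τ ^ 2) = c / 24 / (Real.pi * τ ^ 2) := by
    rw [div_div, mul_assoc]
  have hprob : IsProbabilityMeasure P := hP ▸ CFT.isProbabilityMeasure_shiftedGamma hα hβ
  have hint : ∀ μ : ℝ, μ < Real.pi * τ ^ 2 → Integrable (fun ω : ℝ => Real.exp (μ * ω)) P :=
    fun μ hμ => hP ▸ CFT.integrable_exp_shiftedGamma hα hβ hμ
  have hmgf : ∀ μ : ℝ, μ < Real.pi * τ ^ 2 → ∫ ω, Real.exp (μ * ω) ∂P =
      (Real.exp (-(μ / (Real.pi * τ ^ 2))) / (1 - μ / (Real.pi * τ ^ 2))) ^ (c / 24) :=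
    fun μ hμ => by rw [hP, hω₀, CFT.integral_exp_shiftedGamma hα hβ hμ]
  have hexp : CFT.HasExpMoments P (Real.pi * τ ^ 2) :=
    ⟨hβ, fun t ht => hint t (lt_of_abs_lt ht)⟩
  have hmom : ∀ n : ℕ, ((∫ ω, ω ^ n ∂P : ℝ) : ℂ) = 𝒞.moment (CFT.gaussianFn hτ) n := by
    intro n
    induction n using Nat.twoStepInduction with
    | zero => simp [𝒞.moment_zero]
    | one => rw [hP, hω₀, CFT.integral_id_shiftedGamma hα hβ, 𝒞.moment_one hτ, Complex.ofReal_zero]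
    | more n h0 h1 =>
      rw [𝒞.moment_add_two hτ, ← h0, ← h1, hP, hω₀, CFT.integral_pow_shiftedGamma hα hβ]
      push_cast
      rfl
  have hm : CFT.HasMoments P (𝒞.moment (CFT.gaussianFn hτ)) :=
    fun n => ⟨hexp.integrable_pow n, hmom n⟩
  have hT : ∀ φ ψ : 𝒞.D, inner ℂ (φ : H) (𝒞.T (CFT.gaussianFn hτ) ψ : H)
      = inner ℂ (𝒞.T (CFT.gaussianFn hτ) φ : H) (ψ : H) := fun φ ψ => by
    have h := 𝒞.hermitian (CFT.gaussField hτ) φ ψ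
    rwa [CFT.conjFn_gaussField hτ] at h
  have hqei := CFT.qeiBound_gaussian c hτ
  refine ⟨fun μ hμ => ?_, hprob, fun μ hμ => ⟨hint μ hμ, hmgf μ hμ⟩, hm, fun ν hν => ?_,
    fun A hA hTA => 𝒞.isMeasurementLaw hT hexp hm hA hTA, ?_, ?_, hqei⟩
  · rw [← hmgf μ (lt_of_abs_lt hμ)]
    refine (Complex.hasSum_ofReal.2 (hexp.hasSum_mgf hμ)).congr_fun fun n => ?_
    rw [← hmom]
    push_cast
    rfl
  · have h : ∀ n : ℕ, ∫ ω, ω ^ n ∂ν = ∫ ω, ω ^ n ∂P := fun n => by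
      exact_mod_cast (hν n).2.trans (hmom n).symm
    -- Exponential moments are first transferred to `ν` through its moments; determinacy then
    -- applies to the pair.
    exact ((hexp.eq_of_moments (hexp.of_moments (fun n => (hν n).1) h)) fun n => (h n).symm).symm
  · rw [hqei, hP]
    exact CFT.isLeast_support_shiftedGamma hα hβ
  · rw [hqei]
    refine ⟨?_, fun b hb => ?_⟩
    · rintro x ⟨ψ, h1, hx⟩
      have h := 𝒞.energy_inequality hc hτ ψ
      rwa [← hx, h1, one_pow, mul_one, Complex.ofReal_re] at h
    -- A lower bound `b > -ω₀` would leave no mass below `b`, although the Gamma density is positive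
    -- immediately to the right of `-ω₀`.
    · by_contra! hlt
      refine (hP ▸ CFT.shiftedGamma_Iio hα hβ hlt).ne' ?_
      rw [← Set.Iio_union_Ico_eq_Iio hlt.le]
      exact measure_union_null (hP ▸ CFT.shiftedGamma_Iio_eq_zero)
        (𝒞.measure_Ico_eq_zero_of_lowerBound hT hexp hm hb)
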